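/- Consider a full-duplex access point (AP) located at the origin, with \(n_u>1\) receive antennas and a single transmit antenna, at the centre of a disk of radius \(R_c>0\). Single-antenna downlink (DL) users form a homogeneous Poisson point process of density \(\lambda_d>0\) in this disk. The AP schedules the DL user nearest to it, at distance \(r\), and an uplink (UL) user at a fixed distance \(d\ge 0\) from that DL user, such that the angle \(\theta\) at the DL user between the directions of the AP and of the UL user is uniform on \([0,2\pi]\); thus the UL user is at distance \((r^2+d^2-2rd\cos\theta)^{1/2}\) from the AP, and the path loss of the UL link is \(\ell(x_u)=(r^2+d^2-2rd\cos\theta)^{-\alpha/2}\), with \(\alpha\ge 2\). Let \(\mathbf h_{ua}\in\mathbb C^{n_u\times 1}\) (UL user to AP) and \(h_{ad}\in\mathbb C\) (AP to DL user) have i.i.d. \(\mathcal{CN}(0,1)\) entries, and let the loop-interference channel \(\mathbf h_{aa}\in\mathbb C^{n_u\times 1}\) have i.i.d. \(\mathcal{CN}(0,\sigma_{aa}^2)\) entries, \(\sigma_{aa}^2>0\); the point process, \(\theta\), \(\mathbf h_{ua}\), \(\mathbf h_{aa}\) and \(h_{ad}\) are independent. Let \(P_u,P_a>0\) be the transmit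 powers of the UL user and of the AP. With maximum ratio combining \(\mathbf w_r=\mathbf h_{ua}^\dagger/\|\mathbf h_{ua}\|\), maximum ratio transmission \(w_t=\overline{h_{ad}}/|h_{ad}|\), and no noise, put \[ \mathsf{SINR}_a=\frac{P_u\,\ell(x_u)\,|\mathbf w_r\mathbf h_{ua}|^2}{P_a\,|\mathbf w_r\mathbf h_{aa}w_t|^2} \] if there is a DL user in the disk, and \(\mathsf{SINR}_a=0\) otherwise. Then the average UL rate \(R_a=\mathbb E[\log_2(1+\mathsf{SINR}_a)]\) is finite, and \[ R_a=\frac{\lambda_d}{\Gamma(n_u)}\int_0^\infty\!\int_0^{R_c}\!\int_0^{2\pi} r\,e^{-\lambda_d\pi r^2}\; G^{2,2}_{3,3}\!\left(\frac{P_u}{P_a\sigma_{aa}^2}\,\frac{(r^2+d^2-2rd\cos\theta)^{-\alpha/2}}{2^t-1}\;\middle|\;{1-n_u,\ 1,\ n_u\atop 1,\ n_u,\ 0}\right)d\theta\,dr\,dt, \] where \(G^{m,n}_{p,q}\) is the Meijer G-function and the triple integral converges absolutely. -/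

import Mathlib

open MeasureTheory ProbabilityTheory
open scoped NNReal ENNReal Matrix

noncomputable section

namespace FullDuplex

/-! ### The Meijer G-function -/

/-- The Mellin–Barnes integrand
`∏_{j ≤ m} Γ(b_j - s) ∏_{j ≤ n} Γ(1 - a_j + s) /
  (∏_{j > m} Γ(1 - b_j + s) ∏_{j > n} Γ(a_j - s)) · z ^ s`. -/
def meijerIntegrand (m n : ℕ) {p q : ℕ} (a : Fin p → ℂ) (b : Fin q → ℂ) (z s : ℂ) : ℂ :=
  (∏ j : Fin q, if (j : ℕ) < m then Complex.Gamma (b j - s)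
    else (Complex.Gamma (1 - b j + s))⁻¹) *
  (∏ j : Fin p, if (j : ℕ) < n then Complex.Gamma (1 - a j + s)
    else (Complex.Gamma (a j - s))⁻¹) * z ^ s

/-- The vertical line `Re s = c` has the poles of `Γ(b_j - s)`, `j ≤ m`, on its right and the
poles of `Γ(1 - a_j + s)`, `j ≤ n`, on its left. -/
def SeparatesPoles (m n : ℕ) {p q : ℕ} (a : Fin p → ℂ) (b : Fin q → ℂ) (c : ℝ) : Prop :=
  (∀ j : Fin q, (j : ℕ) < m → c < (b j).re) ∧
  (∀ j : Fin p, (j : ℕ) < n → (a j).re - 1 < c)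

/-- The Meijer G-function `G^{m,n}_{p,q}(z | a₁ … a_p ; b₁ … b_q)`, that is
`(1 / 2πi) ∫_L` of the Mellin–Barnes integrand, the contour `L` being a vertical line from
`c - i∞` to `c + i∞` that separates the two families of poles. It is the standard function for
parameters that admit such a line, `p + q < 2 (m + n)` and `|arg z| < (m + n - (p + q)/2) π`;
the value does not depend on the separating line. -/
def meijerG (m n : ℕ) {p q : ℕ} (a : Fin p → ℂ) (b : Fin q → ℂ) (z : ℂ) : ℂ :=
  let c : ℝ := Classical.epsilon (SeparatesPoles m n a b)
  (1 / (2 * (Real.pi : ℂ))) *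
    ∫ y : ℝ, meijerIntegrand m n a b z ((c : ℂ) + (y : ℂ) * Complex.I)

/-! ### Poisson point processes in the plane `ℂ` -/

open Classical in
/-- The number of points of a finite configuration that lie in `B`. -/
def countIn (B : Set ℂ) (s : Finset ℂ) : ℕ := (s.filter (fun x => x ∈ B)).card

/-- The counting measure `∑_{x ∈ s} δ_x` of a finite configuration. -/
def configMeasure (s : Finset ℂ) : Measure ℂ := ∑ x ∈ s, Measure.dirac x

/-- The counting measure of a configuration counts its points. -/
theorem configMeasure_apply (s : Finset ℂ) {B : Set ℂ} (hB : MeasurableSet B) :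
    configMeasure s B = (countIn B s : ℝ≥0∞) := by
  classical
  simp [configMeasure, countIn, Measure.finsetSum_apply, Measure.dirac_apply' _ hB,
    Set.indicator_apply]

/-- `Φ`, a random finite set of points, is a Poisson point process with intensity measure `Λ`:
as a random measure it is measurable, the number of points in a Borel set `B` with `Λ B < ∞` is
Poisson distributed with mean `Λ B`, and the numbers of points in disjoint Borel sets are
independent. -/
structure IsPoissonProcess {Ω : Type*} [MeasurableSpace Ω] (Φ : Ω → Finset ℂ)
    (Λ : Measure ℂ) (P : Measure Ω) : Prop where
  measurable : Measurable (fun ω => configMeasure (Φ ω))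
  count_law : ∀ B : Set ℂ, MeasurableSet B → Λ B ≠ ∞ →
    HasLaw (fun ω => countIn B (Φ ω)) (poissonMeasure (Λ B).toNNReal) P
  count_indep : ∀ (k : ℕ) (B : Fin k → Set ℂ), (∀ i, MeasurableSet (B i)) →
    Pairwise (Function.onFun Disjoint B) →
    iIndepFun (fun i ω => countIn (B i) (Φ ω)) P

/-! ### Fading -/

/-- The circularly symmetric complex Gaussian law `𝒞𝒩(0, v)`: real and imaginary parts are
independent centred Gaussians of variance `v / 2`. -/
def complexGaussian (v : ℝ≥0) : Measure ℂ :=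
  ((gaussianReal 0 (v / 2)).prod (gaussianReal 0 (v / 2))).map
    Complex.measurableEquivRealProd.symm

/-- Euclidean norm of a complex vector. -/
def vnorm {k : ℕ} (v : Fin k → ℂ) : ℝ := ‖WithLp.toLp 2 v‖

/-- The normalized Hermitian transpose `h† / ‖h‖`: the MRC combining (row) vector when `h` is
the channel column vector from the UL user to the AP, and the MRT precoding (column) vector when
`h` is the channel row vector from the AP to the DL user. -/
def matched {k : ℕ} (h : Fin k → ℂ) : Fin k → ℂ := fun i => star (h i) / (vnorm h : ℂ)

/-! ### Geometry and SINR -/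

/-- Singular path loss `‖x‖ ^ (-α)` between the point `x` and the AP at the origin. -/
def pathLoss (α : ℝ) (x : ℂ) : ℝ := ‖x‖ ^ (-α)

/-- Distance from the AP (at the origin) to the nearest point of the configuration. -/
def nearestDist (s : Finset ℂ) : ℝ :=
  if h : s.Nonempty then s.inf' h (fun x => ‖x‖) else 0

/-- Position of the UL user in the coordinate system in which the AP is the origin and the
scheduled DL user is at `(r, 0)`: it is at distance `d` from the DL user, and `θ` is the angle at
the DL user between the directions of the AP and of the UL user. -/
def ulPosition (d r θ : ℝ) : ℂ := (r : ℂ) - (d : ℂ) * Complex.exp ((θ : ℂ) * Complex.I)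

/-- SINR at the AP for UL user position `xu`, receive combiner `wr`, transmit precoder `wt`,
UL channel `h`, loop-interference channel `H` and noise variance `noise`. -/
def sinrAP {nu nd : ℕ} (Pu Pa α noise : ℝ) (xu : ℂ) (wr h : Fin nu → ℂ)
    (H : Matrix (Fin nu) (Fin nd) ℂ) (wt : Fin nd → ℂ) : ℝ :=
  (Pu * pathLoss α xu * ‖wr ⬝ᵥ h‖ ^ 2) /
    (Pa * ‖wr ⬝ᵥ (H *ᵥ wt)‖ ^ 2 + noise * vnorm wr ^ 2)

/-- The random quantities of the system: locations of the DL users, direction of the UL user,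
UL user to AP channel, AP to AP (loop-interference) channel, AP to DL user channel. -/
structure System (Ω : Type*) (nu nd : ℕ) where
  users : Ω → Finset ℂ
  theta : Ω → ℝ
  hua : Ω → (Fin nu → ℂ)
  haa : Ω → (Fin nu → Fin nd → ℂ)
  had : Ω → (Fin nd → ℂ)

/-- The distributional assumptions: DL users form a homogeneous Poisson process of density `dens`
in the disk of radius `Rc`; the angle is uniform on `[0, 2π]`; the entries of the UL and DL
channels are i.i.d. `𝒞𝒩(0, 1)` and those of the loop-interference channel are i.i.d.
`𝒞𝒩(0, σ2)`. The last four fields together say that the five random objects are mutually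
independent. -/
structure System.IsModel {Ω : Type*} [MeasurableSpace Ω] {nu nd : ℕ} (S : System Ω nu nd)
    (dens σ2 : ℝ≥0) (Rc : ℝ) (P : Measure Ω) : Prop where
  users_poisson :
    IsPoissonProcess S.users (dens • (volume.restrict (Metric.closedBall (0 : ℂ) Rc))) P
  theta_law : HasLaw S.theta (cond volume (Set.Icc 0 (2 * Real.pi))) P
  hua_law : HasLaw S.hua (Measure.pi fun _ => complexGaussian 1) P
  haa_law : HasLaw S.haa (Measure.pi fun _ => Measure.pi fun _ => complexGaussian σ2) P
  had_law : HasLaw S.had (Measure.pi fun _ => complexGaussian 1) P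
  users_indep : IndepFun (fun ω => configMeasure (S.users ω))
    (fun ω => (S.theta ω, S.hua ω, S.haa ω, S.had ω)) P
  theta_indep : IndepFun S.theta (fun ω => (S.hua ω, S.haa ω, S.had ω)) P
  hua_indep : IndepFun S.hua (fun ω => (S.haa ω, S.had ω)) P
  haa_indep : IndepFun S.haa S.had P

/-- `SINR_a` under MRC reception and MRT transmission, the nearest DL user being scheduled. If
there is no DL user in the cell, no user pair is scheduled and the SINR is set to `0`. -/
def System.sinrMrcMrt {Ω : Type*} {nu nd : ℕ} (S : System Ω nu nd) (Pu Pa α d noise : ℝ)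
    (ω : Ω) : ℝ :=
  if (S.users ω).Nonempty then
    sinrAP Pu Pa α noise (ulPosition d (nearestDist (S.users ω)) (S.theta ω))
      (matched (S.hua ω)) (S.hua ω) (Matrix.of (S.haa ω)) (matched (S.had ω))
  else 0

/-- The instantaneous UL rate `log₂ (1 + SINR_a)`. -/
def System.ulRate {Ω : Type*} {nu nd : ℕ} (S : System Ω nu nd) (Pu Pa α d noise : ℝ)
    (ω : Ω) : ℝ :=
  Real.logb 2 (1 + S.sinrMrcMrt Pu Pa α d noise ω)

/-- The integrand, in the variables `t`, `r`, `θ`, of the triple integral for the UL rate. -/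
def rateIntegrand (nu : ℕ) (dens σ2 : ℝ≥0) (Pu Pa α d t r θ : ℝ) : ℂ :=
  ((r * Real.exp (-(dens : ℝ) * Real.pi * r ^ 2) : ℝ) : ℂ) *
    meijerG 2 2 ![1 - (nu : ℂ), 1, (nu : ℂ)] ![1, (nu : ℂ), 0]
      ((Pu / (Pa * (σ2 : ℝ)) * (1 / ((2 : ℝ) ^ t - 1)) *
        (r ^ 2 + d ^ 2 - 2 * r * d * Real.cos θ) ^ (-(α / 2)) : ℝ) : ℂ)

end FullDuplex

end

/-! The theorem rests on the identity
`G^{2,2}_{3,3}(z | 1 - n, 1, n; 1, n, 0) = Γ(n) (1 - (1 + z)⁻ⁿ)` for `z ≥ 0` and on the tail formula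
`P(SINR > x | r, θ) = 1 - (1 + z)⁻ⁿ` with `z = P_u ℓ(x_u) / (P_a σ² x)`, where `n` is the number of
receive antennas.

For the identity (`meijerG_eq`), the factors `Γ(n - s)` cancel, `Γ(s) / Γ(1 + s) = 1 / s`, and the
Mellin–Barnes integrand becomes `Γ(1 - s) Γ(n + s) z ^ s / s` on a line `0 < Re s < 1`. Up to the
factor `Γ(n)` this is the Mellin transform of `1 - (1 + x)⁻ⁿ` at `-s`
(`hasMellin_one_sub_inv_one_add_pow`), so that Mellin inversion gives the value.

For the tail (`fading_lt_sinrAP`), the combined loop interference `w_r H w_t` is `𝒞𝒩(0, σ²)` because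
the combiner and the precoder are unit vectors that are independent of `H`
(`map_dotProduct_mulVec_complexGaussian`); its squared modulus is exponential, which leaves
`1 - E[exp (-z ‖h‖²)]`, the Laplace transform of a Gamma law.

The distance `r` of the nearest user has density `2π λ r exp (-λ π r²)` on `(0, R_c]`, by the void
probabilities of the Poisson process (`map_nearestDist`). The layer cake formula
`E[R] = ∫ P(R > t) dt` over `t > 0`, with `R = log₂ (1 + SINR) > t` if and only if
`SINR > 2 ^ t - 1`, then gives the triple integral. The integrand is nonnegative, and it is integrable
because `1 - (1 + z)⁻ⁿ ≤ n z ^ p` for a small `p > 0` (`integrableOn_rateKernel`); this also gives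
the finiteness of the average rate. -/

noncomputable section
namespace FullDuplex

/-! ### Mellin transforms and the Meijer G-function -/

/-- The Mellin transform of `(1 + x)⁻ᵏ` is the beta function. It follows from writing
`Γ(k) (1 + x)⁻ᵏ` as a Gamma integral and exchanging the order of integration. -/
theorem hasMellin_inv_one_add_pow (k : ℕ) {s : ℂ} (hs : 0 < s.re) (hsk : s.re < k) :
    HasMellin (fun x : ℝ => (((1 + x : ℝ) : ℂ) ^ k)⁻¹) s
      (Complex.Gamma s * Complex.Gamma (k - s) / Complex.Gamma k) := by
  have hk : (0 : ℝ) < k := hs.trans hsk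
  have hΓ : Complex.Gamma k ≠ 0 := Complex.Gamma_ne_zero_of_re_pos (by simpa using hk)
  set μ : Measure ℝ := volume.restrict (Set.Ioi 0) with hμ
  let F : ℝ × ℝ → ℂ := fun p => (p.1 : ℂ) ^ (s - 1) *
    ((p.2 : ℂ) ^ ((k : ℂ) - 1) * Complex.exp (-(((1 + p.1 : ℝ) : ℂ) * p.2)))
  have hFm : Measurable F := by
    refine Measurable.mul ?_ (Measurable.mul ?_ ?_)
    · exact (Complex.measurable_ofReal.comp measurable_fst).pow_const _
    · exact (Complex.measurable_ofReal.comp measurable_snd).pow_const _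
    · fun_prop
  have hnorm : ∀ x > 0, ∀ y > 0, ‖F (x, y)‖ =
      (y ^ ((k : ℝ) - 1) * Real.exp (-y)) * (x ^ (s.re - 1) * Real.exp (-(y * x))) := by
    intro x hx y hy
    simp only [F, norm_mul, Complex.norm_cpow_eq_rpow_re_of_pos hx,
      Complex.norm_cpow_eq_rpow_re_of_pos hy, Complex.norm_exp]
    have h1 : (-(((1 + x : ℝ) : ℂ) * (y : ℂ))).re = -y + -(y * x) := by
      rw [← Complex.ofReal_mul, ← Complex.ofReal_neg, Complex.ofReal_re]; ring
    rw [h1, Real.exp_add]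
    simp only [Complex.sub_re, Complex.natCast_re, Complex.one_re]
    ring
  have hxint : ∀ y > 0, ∫ x, ‖F (x, y)‖ ∂μ =
      Real.Gamma s.re * (Real.exp (-y) * y ^ (((k : ℝ) - s.re) - 1)) := by
    intro y hy
    rw [hμ, setIntegral_congr_fun measurableSet_Ioi (fun x hx => hnorm x hx y hy),
      integral_const_mul, Real.integral_rpow_mul_exp_neg_mul_Ioi hs hy,
      show (k : ℝ) - s.re - 1 = (k - 1) + (-s.re) by ring, Real.rpow_add hy, one_div,
      Real.inv_rpow hy.le, Real.rpow_neg hy.le]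
    ring
  have hFi : Integrable F (μ.prod μ) := by
    rw [integrable_prod_iff' hFm.aestronglyMeasurable]
    constructor
    · refine (ae_restrict_iff' measurableSet_Ioi).2 (Filter.Eventually.of_forall fun y hy => ?_)
      have hy : 0 < y := hy
      have h := Real.Gamma_pos_of_pos hs
      refine ⟨(hFm.comp measurable_prodMk_right).aestronglyMeasurable, ?_⟩
      have : Integrable (fun x => ‖F (x, y)‖) μ := by
        refine Integrable.of_integral_ne_zero ?_
        rw [hxint y hy]
        positivity
      exact this.hasFiniteIntegral.congr' (Filter.Eventually.of_forall (by simp))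
    · have h := (Real.GammaIntegral_convergent (sub_pos.2 hsk)).const_mul (Real.Gamma s.re)
      refine (IntegrableOn.congr_fun h (fun y hy => ?_) measurableSet_Ioi)
      exact (hxint y hy).symm
  have hyint : ∀ x ∈ Set.Ioi (0 : ℝ), ∫ y, F (x, y) ∂μ =
      (x : ℂ) ^ (s - 1) • ((((1 + x : ℝ) : ℂ) ^ k)⁻¹ * Complex.Gamma k) := by
    intro x hx
    have hx : 0 < x := hx
    simp only [F]
    rw [hμ, integral_const_mul, Complex.integral_cpow_mul_exp_neg_mul_Ioi
      (show 0 < (k : ℂ).re by simpa using hk)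
      (show 0 < 1 + x by positivity)]
    simp [Complex.cpow_natCast]
  have hyint' : ∀ y ∈ Set.Ioi (0 : ℝ), ∫ x, F (x, y) ∂μ =
      Complex.Gamma s * (((-y).exp : ℝ) * (y : ℂ) ^ (((k : ℂ) - s) - 1)) := by
    intro y hy
    have hy : 0 < y := hy
    have e : ∀ x : ℝ, F (x, y) = ((y : ℂ) ^ ((k : ℂ) - 1) * Complex.exp (-y)) *
        ((x : ℂ) ^ (s - 1) * Complex.exp (-((y : ℂ) * x))) := by
      intro x
      simp only [F]
      rw [show -(((1 + x : ℝ) : ℂ) * (y : ℂ)) = -(y : ℂ) + -((y : ℂ) * x) by push_cast; ring,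
        Complex.exp_add]
      ring
    have hy0 : (y : ℂ) ≠ 0 := by exact_mod_cast hy.ne'
    simp_rw [e]
    rw [hμ, integral_const_mul, Complex.integral_cpow_mul_exp_neg_mul_Ioi hs (by simpa using hy),
      show (k : ℂ) - s - 1 = (k - 1) + (-s) by ring, Complex.cpow_add _ _ hy0, one_div,
      Complex.inv_cpow _ _ (by
        rw [Complex.arg_ofReal_of_nonneg hy.le]; exact Real.pi_pos.ne), Complex.cpow_neg]
    push_cast
    ring
  refine ⟨?_, ?_⟩
  · have h := hFi.integral_prod_left
    have h2 : IntegrableOn (fun x : ℝ => (x : ℂ) ^ (s - 1) •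
        ((((1 + x : ℝ) : ℂ) ^ k)⁻¹ * Complex.Gamma k)) (Set.Ioi 0) :=
      IntegrableOn.congr_fun h hyint measurableSet_Ioi
    refine (h2.mul_const (Complex.Gamma k)⁻¹).congr (Filter.Eventually.of_forall fun x => ?_)
    simp only [smul_eq_mul]
    field_simp
  · have h := integral_integral_swap (f := fun x y => F (x, y)) hFi
    rw [hμ, setIntegral_congr_fun measurableSet_Ioi hyint,
      setIntegral_congr_fun measurableSet_Ioi hyint', integral_const_mul,
      ← Complex.GammaIntegral, ← Complex.Gamma_eq_integral (by simpa using hsk)] at h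
    rw [eq_div_iff hΓ, ← h, mellin, ← integral_mul_const]
    simp only [smul_eq_mul, mul_assoc]

/-- The Mellin transform of `1 - (1 + x)⁻ⁿ` in the strip `-1 < Re s < 0`, obtained by
telescoping `1 - (1 + x)⁻ⁿ = ∑_{k ≤ n} x (1 + x)⁻ᵏ`. -/
theorem hasMellin_one_sub_inv_one_add_pow (n : ℕ) (hn : 1 ≤ n) {s : ℂ} (hs : 0 < s.re)
    (hs1 : s.re < 1) :
    HasMellin (fun x : ℝ => 1 - (((1 + x : ℝ) : ℂ) ^ n)⁻¹) (-s)
      (Complex.Gamma (1 - s) * Complex.Gamma (n + s) / (s * Complex.Gamma n)) := by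
  have hs0 : s ≠ 0 := by rintro rfl; simp at hs
  have step : ∀ k : ℕ, 1 ≤ k → HasMellin (fun x : ℝ => (x : ℂ) * (((1 + x : ℝ) : ℂ) ^ k)⁻¹) (-s)
      (Complex.Gamma (1 - s) * Complex.Gamma (k - 1 + s) / Complex.Gamma k) := by
    intro k hk
    have hk1 : (1 : ℝ) ≤ k := by exact_mod_cast hk
    have h := hasMellin_inv_one_add_pow k (s := -s + 1) (by simpa using hs1)
      (by simp; linarith)
    refine ⟨?_, ?_⟩
    · have := (MellinConvergent.cpow_smul (f := fun x : ℝ => (((1 + x : ℝ) : ℂ) ^ k)⁻¹)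
        (s := -s) (a := 1)).2 h.1
      simpa using this
    · have := mellin_cpow_smul (fun x : ℝ => (((1 + x : ℝ) : ℂ) ^ k)⁻¹) (-s) 1
      rw [h.2] at this
      simp only [Complex.cpow_one, smul_eq_mul] at this
      rw [this]
      congr 3 <;> ring
  induction n, hn using Nat.le_induction with
  | base =>
    have h := step 1 le_rfl
    have hfun : Set.EqOn (fun x : ℝ => (x : ℂ) * (((1 + x : ℝ) : ℂ) ^ 1)⁻¹)
        (fun x : ℝ => 1 - (((1 + x : ℝ) : ℂ) ^ 1)⁻¹) (Set.Ioi 0) := by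
      intro x hx
      have hx : 0 < x := hx
      have : ((1 + x : ℝ) : ℂ) ≠ 0 := by exact_mod_cast (by positivity : (1 + x) ≠ 0)
      simp only [pow_one]
      field_simp
      push_cast; ring
    have hsG : Complex.Gamma (((1 : ℕ) : ℂ) + s) = s * Complex.Gamma s := by
      rw [Nat.cast_one, add_comm, Complex.Gamma_add_one s hs0]
    have hval : Complex.Gamma (1 - s) * Complex.Gamma (((1 : ℕ) : ℂ) + s) /
        (s * Complex.Gamma ((1 : ℕ) : ℂ)) =
        Complex.Gamma (1 - s) * Complex.Gamma (((1 : ℕ) : ℂ) - 1 + s) /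
          Complex.Gamma ((1 : ℕ) : ℂ) := by
      rw [hsG]
      simp
      field_simp
    rw [hval]
    refine ⟨?_, ?_⟩
    · exact IntegrableOn.congr_fun h.1 (fun x hx => by simp only [hfun hx]) measurableSet_Ioi
    · rw [← h.2]
      exact setIntegral_congr_fun measurableSet_Ioi (fun x hx => by simp only [hfun hx])
  | succ n hn ih =>
    have hn0 : (n : ℂ) ≠ 0 := by exact_mod_cast (by omega : n ≠ 0)
    have hΓ : Complex.Gamma n ≠ 0 :=
      Complex.Gamma_ne_zero_of_re_pos (by simp; omega)
    have h := hasMellin_add ih.1 (step (n + 1) (by omega)).1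
    rw [ih.2, (step (n + 1) (by omega)).2] at h
    have hfun : Set.EqOn (fun x : ℝ => 1 - (((1 + x : ℝ) : ℂ) ^ n)⁻¹ +
        (x : ℂ) * (((1 + x : ℝ) : ℂ) ^ (n + 1))⁻¹)
        (fun x : ℝ => 1 - (((1 + x : ℝ) : ℂ) ^ (n + 1))⁻¹) (Set.Ioi 0) := by
      intro x hx
      have hx : 0 < x := hx
      have : ((1 + x : ℝ) : ℂ) ≠ 0 := by exact_mod_cast (by positivity : (1 + x) ≠ 0)
      simp only [pow_succ]
      field_simp
      push_cast; ring
    have hns : (n : ℂ) + s ≠ 0 := by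
      intro h0
      have := congrArg Complex.re h0
      simp at this
      linarith
    have hval : Complex.Gamma (1 - s) * Complex.Gamma (((n + 1 : ℕ) : ℂ) + s) /
        (s * Complex.Gamma ((n + 1 : ℕ) : ℂ)) =
        Complex.Gamma (1 - s) * Complex.Gamma (n + s) / (s * Complex.Gamma n) +
        Complex.Gamma (1 - s) * Complex.Gamma (((n + 1 : ℕ) : ℂ) - 1 + s) /
          Complex.Gamma ((n + 1 : ℕ) : ℂ) := by
      rw [show ((n + 1 : ℕ) : ℂ) + s = (n + s) + 1 by push_cast; ring,
        show ((n + 1 : ℕ) : ℂ) - 1 + s = n + s by push_cast; ring,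
        Complex.Gamma_add_one _ hns, Nat.cast_add, Nat.cast_one, Complex.Gamma_add_one _ hn0]
      field_simp
    rw [hval]
    refine ⟨?_, ?_⟩
    · exact IntegrableOn.congr_fun h.1 (fun x hx => by simp only [← hfun hx])
        measurableSet_Ioi
    · rw [← h.2]
      exact setIntegral_congr_fun measurableSet_Ioi (fun x hx => by simp only [← hfun hx])

/-- Along vertical lines in the right half-plane the Gamma function is bounded. -/
theorem norm_Gamma_le_Gamma_re {s : ℂ} (hs : 0 < s.re) : ‖Complex.Gamma s‖ ≤ Real.Gamma s.re := by
  rw [Complex.Gamma_eq_integral hs, Real.Gamma_eq_integral hs, Complex.GammaIntegral]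
  refine (norm_integral_le_integral_norm _).trans (le_of_eq ?_)
  refine setIntegral_congr_fun measurableSet_Ioi fun x hx => ?_
  have hx : 0 < x := hx
  simp [Complex.norm_cpow_eq_rpow_re_of_pos hx, Complex.norm_exp]

/-- The Mellin transform of `1 - (1 + x)⁻ⁿ` is integrable along vertical lines: two steps of the
recurrence for `Γ(1 - s)` give decay like `|Im s|⁻²`. -/
theorem integrable_Gamma_mul_Gamma_div (n : ℕ) {c : ℝ} (hc : 0 < c) (hc1 : c < 1) :
    Integrable fun y : ℝ => Complex.Gamma (1 - (c + y * Complex.I)) *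
      Complex.Gamma (n + (c + y * Complex.I)) / (c + y * Complex.I) := by
  have hre : ∀ y : ℝ, ((c : ℂ) + y * Complex.I).re = c := by simp
  have him : ∀ y : ℝ, ((c : ℂ) + y * Complex.I).im = y := by simp
  have h0 : ∀ y : ℝ, (c : ℂ) + y * Complex.I ≠ 0 := fun y h => by
    have := hre y; rw [h] at this; simp at this; linarith
  have hcont : Continuous fun y : ℝ => Complex.Gamma (1 - (c + y * Complex.I)) *
      Complex.Gamma (n + (c + y * Complex.I)) / (c + y * Complex.I) := by
    have hG : ∀ s : ℂ, 0 < s.re → ContinuousAt Complex.Gamma s := fun s hs =>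
      (Complex.differentiableAt_Gamma s fun m h => by
        rw [h] at hs; simp at hs
        linarith).continuousAt
    refine Continuous.div (Continuous.mul ?_ ?_) (by fun_prop) h0
    · refine continuous_iff_continuousAt.2 fun y => ?_
      exact ContinuousAt.comp (f := fun y : ℝ => 1 - ((c : ℂ) + y * Complex.I))
        (hG _ (by simp; linarith)) (by fun_prop)
    · refine continuous_iff_continuousAt.2 fun y => ?_
      exact ContinuousAt.comp (f := fun y : ℝ => (n : ℂ) + ((c : ℂ) + y * Complex.I))
        (hG _ (by simp; positivity)) (by fun_prop)
  -- `Γ(1 - s) = Γ(3 - s) / ((1 - s) (2 - s))`, where `|Γ(3 - s)| ≤ Γ(3 - c)`.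
  set K := Real.Gamma (3 - c) * Real.Gamma (n + c) / ((1 - c) ^ 2 * c) with hK
  have hΓ1 : 0 < Real.Gamma (3 - c) := Real.Gamma_pos_of_pos (by linarith)
  refine (integrable_inv_one_add_sq.const_mul K).mono' hcont.aestronglyMeasurable
    (Filter.Eventually.of_forall fun y => ?_)
  set s : ℂ := c + y * Complex.I with hs
  have hsre : s.re = c := hre y
  have hsim : s.im = y := him y
  have h1 : (1 - s) ≠ 0 := fun h => by
    have := congrArg Complex.re h; simp [hsre] at this; linarith
  have h2 : (1 - s + 1) ≠ 0 := fun h => by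
    have := congrArg Complex.re h; simp [hsre] at this; linarith
  have e : Complex.Gamma (1 - s) = Complex.Gamma (3 - s) / ((1 - s) * (1 - s + 1)) := by
    rw [show (3 : ℂ) - s = (1 - s + 1) + 1 by ring, Complex.Gamma_add_one _ h2,
      Complex.Gamma_add_one _ h1]
    field_simp
  have n1 : (1 - c) ^ 2 * (1 + y ^ 2) ≤ ‖(1 - s) * (1 - s + 1)‖ := by
    have a1 : ‖1 - s‖ ^ 2 = (1 - c) ^ 2 + y ^ 2 := by
      rw [← Complex.normSq_eq_norm_sq, Complex.normSq_apply]; simp [hsre, hsim]; ring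
    have a2 : ‖1 - s + 1‖ ^ 2 = (2 - c) ^ 2 + y ^ 2 := by
      rw [← Complex.normSq_eq_norm_sq, Complex.normSq_apply]; simp [hsre, hsim]; ring
    rw [norm_mul]
    refine le_of_sq_le_sq ?_ (by positivity)
    rw [mul_pow ‖1 - s‖, a1, a2, mul_pow]
    have b0 : (1 - c) ^ 2 ≤ 1 := by nlinarith
    have b1 : (1 - c) ^ 2 * (1 + y ^ 2) ≤ (1 - c) ^ 2 + y ^ 2 := by nlinarith [sq_nonneg y]
    have b2 : (1 - c) ^ 2 * (1 + y ^ 2) ≤ (2 - c) ^ 2 + y ^ 2 := by nlinarith [sq_nonneg y]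
    calc ((1 - c) ^ 2) ^ 2 * (1 + y ^ 2) ^ 2
        = ((1 - c) ^ 2 * (1 + y ^ 2)) * ((1 - c) ^ 2 * (1 + y ^ 2)) := by ring
      _ ≤ _ := mul_le_mul b1 b2 (by positivity) (by positivity)
  have n2 : ‖Complex.Gamma (3 - s)‖ ≤ Real.Gamma (3 - c) := by
    have := norm_Gamma_le_Gamma_re (s := 3 - s) (by simp [hsre]; linarith)
    simpa [hsre] using this
  have n3 : ‖Complex.Gamma (n + s)‖ ≤ Real.Gamma (n + c) := by
    have := norm_Gamma_le_Gamma_re (s := n + s) (by simp [hsre]; positivity)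
    simpa [hsre] using this
  have n4 : c ≤ ‖s‖ := by
    have := Complex.abs_re_le_norm s
    rwa [hsre, abs_of_pos hc] at this
  rw [e, norm_div, norm_mul, norm_div]
  calc ‖Complex.Gamma (3 - s)‖ / ‖(1 - s) * (1 - s + 1)‖ * ‖Complex.Gamma (n + s)‖ / ‖s‖
      ≤ Real.Gamma (3 - c) / ((1 - c) ^ 2 * (1 + y ^ 2)) * Real.Gamma (n + c) / c := by
        gcongr
    _ = K * (1 + y ^ 2)⁻¹ := by
        rw [hK]; field_simp

/-- The Meijer G-function of the rate formula is elementary. -/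
theorem meijerG_eq (n : ℕ) (hn : 1 < n) {z : ℝ} (hz : 0 ≤ z) :
    meijerG 2 2 ![1 - (n : ℂ), 1, (n : ℂ)] ![1, (n : ℂ), 0] (z : ℂ) =
      ((Real.Gamma n * (1 - ((1 + z) ^ n)⁻¹) : ℝ) : ℂ) := by
  have hn1 : (1 : ℝ) < n := by exact_mod_cast hn
  have hex : ∃ c, SeparatesPoles 2 2 ![1 - (n : ℂ), 1, (n : ℂ)] ![1, (n : ℂ), 0] c := by
    refine ⟨1 / 2, ?_, ?_⟩ <;> intro j hj <;> fin_cases j <;> simp at hj ⊢ <;> norm_num <;> linarith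
  have hc := Classical.epsilon_spec hex
  unfold meijerG
  set c := Classical.epsilon (SeparatesPoles 2 2 ![1 - (n : ℂ), 1, (n : ℂ)] ![1, (n : ℂ), 0])
  have hc1 : c < 1 := by simpa using hc.1 0 (by norm_num)
  have hc0 : 0 < c := by simpa using hc.2 1 (by norm_num)
  clear_value c
  have hI : ∀ y : ℝ, meijerIntegrand 2 2 ![1 - (n : ℂ), 1, (n : ℂ)] ![1, (n : ℂ), 0] z
      ((c : ℂ) + (y : ℂ) * Complex.I) =
      (Complex.Gamma (1 - (c + y * Complex.I)) *
      Complex.Gamma (n + (c + y * Complex.I)) / (c + y * Complex.I)) *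
        (z : ℂ) ^ ((c : ℂ) + (y : ℂ) * Complex.I) := by
    intro y
    have hsre : ((c : ℂ) + y * Complex.I).re = c := by simp
    set s : ℂ := c + y * Complex.I
    have hs0 : s ≠ 0 := fun h => by rw [h] at hsre; simp at hsre; linarith
    have g1 : Complex.Gamma (n - s) ≠ 0 :=
      Complex.Gamma_ne_zero_of_re_pos (by simp [hsre]; linarith)
    have g2 : Complex.Gamma s ≠ 0 := Complex.Gamma_ne_zero_of_re_pos (by rw [hsre]; exact hc0)
    have g3 : Complex.Gamma (1 - 0 + s) = s * Complex.Gamma s := by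
      rw [sub_zero, add_comm, Complex.Gamma_add_one s hs0]
    have e1 : (1 : ℂ) - (1 - n) + s = n + s := by ring
    have e2 : (1 : ℂ) - 1 + s = s := by ring
    simp [meijerIntegrand, Fin.prod_univ_three, -sub_zero, -sub_self, -sub_sub_cancel, g3, e1, e2]
    left
    field_simp
  simp_rw [hI]
  -- At `z = 0` both sides vanish, since `0 ^ s = 0` for `s ≠ 0`.
  rcases hz.eq_or_lt with rfl | hz
  · have : ∀ y : ℝ, (0 : ℂ) ^ ((c : ℂ) + (y : ℂ) * Complex.I) = 0 := fun y => by
      rw [Complex.zero_cpow]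
      intro h
      have := congrArg Complex.re h
      simp at this; linarith
    simp [this]
  · have hMre : ∀ y : ℝ, ((c : ℂ) + y * Complex.I).re = c := by simp
    have hM : ∀ y : ℝ, HasMellin (fun x : ℝ => 1 - (((1 + x : ℝ) : ℂ) ^ n)⁻¹)
        (-(c + y * Complex.I)) (Complex.Gamma (1 - (c + y * Complex.I)) *
          Complex.Gamma (n + (c + y * Complex.I)) /
            ((c + y * Complex.I) * Complex.Gamma n)) := fun y =>
      hasMellin_one_sub_inv_one_add_pow n hn.le (by rw [hMre]; exact hc0)
        (by rw [hMre]; exact hc1)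
    have hΓ : Complex.Gamma n ≠ 0 :=
      Complex.Gamma_ne_zero_of_re_pos (by simp; omega)
    have e : ∀ y : ℝ, (((-c : ℝ) : ℂ) + y * Complex.I) = -(c + ((-y : ℝ) : ℂ) * Complex.I) := by
      intro y; push_cast; ring
    have hint := integrable_Gamma_mul_Gamma_div n hc0 hc1
    have hv : Complex.VerticalIntegrable
        (mellin (fun x : ℝ => 1 - (((1 + x : ℝ) : ℂ) ^ n)⁻¹)) (-c) := by
      unfold Complex.VerticalIntegrable
      simp_rw [e, fun y => (hM y).2]
      refine (hint.comp_neg.mul_const (Complex.Gamma n)⁻¹).congr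
        (Filter.Eventually.of_forall fun y => ?_)
      simp only [div_eq_mul_inv, mul_inv, mul_assoc]
    have hinv := mellinInv_mellin_eq (-c) (fun x : ℝ => 1 - (((1 + x : ℝ) : ℂ) ^ n)⁻¹) hz
      (by simpa using (hM 0).1) hv (by
        have : ((1 + z : ℝ) : ℂ) ^ n ≠ 0 := by
          exact_mod_cast (by positivity : (1 + z) ^ n ≠ 0)
        fun_prop (disch := assumption))
    unfold mellinInv at hinv
    simp_rw [e, fun y => (hM y).2, neg_neg] at hinv
    rw [integral_neg_eq_self (fun y : ℝ => (z : ℂ) ^ ((c : ℂ) + (y : ℂ) * Complex.I) •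
      (Complex.Gamma (1 - (c + y * Complex.I)) *
          Complex.Gamma (n + (c + y * Complex.I)) /
            ((c + y * Complex.I) * Complex.Gamma n)))] at hinv
    push_cast at hinv ⊢
    have hΓr : Complex.Gamma n = ((Real.Gamma n : ℝ) : ℂ) := by
      rw [← Complex.Gamma_ofReal, Complex.ofReal_natCast]
    rw [hΓr] at hΓ
    simp_rw [hΓr] at hinv
    rw [← hinv, ← smul_eq_mul ((Real.Gamma n : ℝ) : ℂ), smul_comm, ← integral_smul,
      Complex.real_smul]
    push_cast
    congr 2
    ext y
    simp only [smul_eq_mul]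
    field_simp

/-! ### Complex Gaussian vectors -/

instance isProbabilityMeasure_complexGaussian (v : ℝ≥0) :
    IsProbabilityMeasure (complexGaussian v) :=
  Measure.isProbabilityMeasure_map Complex.measurableEquivRealProd.symm.measurable.aemeasurable

theorem real_inner_complex (x t : ℂ) : inner ℝ x t = x.re * t.re + x.im * t.im := by
  rw [Complex.inner]
  simp
  ring

theorem charFun_complexGaussian (v : ℝ≥0) (t : ℂ) :
    charFun (complexGaussian v) t = Complex.exp (-((v : ℝ) * ‖t‖ ^ 2 / 4 : ℝ)) := by
  rw [charFun_apply, complexGaussian, integral_map_equiv]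
  have h : ∀ p : ℝ × ℝ, Complex.exp
      ((inner ℝ (Complex.measurableEquivRealProd.symm p) t : ℝ) * Complex.I) =
      Complex.exp (t.re * p.1 * Complex.I) * Complex.exp (t.im * p.2 * Complex.I) := by
    intro p
    rw [← Complex.exp_add, real_inner_complex]
    congr 1
    have h1 : (Complex.measurableEquivRealProd.symm p).re = p.1 := rfl
    have h2 : (Complex.measurableEquivRealProd.symm p).im = p.2 := rfl
    rw [h1, h2]
    push_cast; ring
  simp_rw [h]
  rw [integral_prod_mul (fun x : ℝ => Complex.exp (t.re * x * Complex.I))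
    (fun y : ℝ => Complex.exp (t.im * y * Complex.I)), ← charFun_apply_real,
    ← charFun_apply_real, charFun_gaussianReal, charFun_gaussianReal, ← Complex.exp_add,
    ← Complex.normSq_eq_norm_sq, Complex.normSq_apply]
  congr 1
  push_cast
  ring

theorem vnorm_sq {k : ℕ} (v : Fin k → ℂ) : vnorm v ^ 2 = ∑ i, ‖v i‖ ^ 2 := by
  rw [vnorm, EuclideanSpace.norm_sq_eq]

/-- A bilinear form `w H u` with unit vectors `w`, `u` in a matrix `H` of i.i.d. complex Gaussian
entries is again complex Gaussian, with the variance of an entry. -/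
theorem map_dotProduct_mulVec_complexGaussian {m n : ℕ} (v : ℝ≥0) {w : Fin m → ℂ} {u : Fin n → ℂ}
    (hw : vnorm w = 1) (hu : vnorm u = 1) :
    (Measure.pi fun _ : Fin m => Measure.pi fun _ : Fin n => complexGaussian v).map
      (fun H => w ⬝ᵥ (Matrix.of H *ᵥ u)) = complexGaussian v := by
  have hm : Measurable fun H : Fin m → Fin n → ℂ => w ⬝ᵥ (Matrix.of H *ᵥ u) := by
    simp only [dotProduct, Matrix.mulVec, Matrix.of_apply]
    fun_prop
  have := Measure.isProbabilityMeasure_map (μ := Measure.pi fun _ : Fin m =>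
    Measure.pi fun _ : Fin n => complexGaussian v) hm.aemeasurable
  refine Measure.ext_of_charFun (funext fun t => ?_)
  rw [charFun_apply, integral_map hm.aemeasurable (by fun_prop)]
  have h : ∀ H : Fin m → Fin n → ℂ,
      Complex.exp ((inner ℝ (w ⬝ᵥ (Matrix.of H *ᵥ u)) t : ℝ) * Complex.I) =
      ∏ i, ∏ j, Complex.exp ((inner ℝ (H i j) (star (w i * u j) * t) : ℝ) * Complex.I) := by
    intro H
    simp_rw [← Complex.exp_sum, ← Finset.sum_mul]
    congr 2
    simp only [dotProduct, Matrix.mulVec, Matrix.of_apply, Finset.mul_sum, sum_inner]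
    push_cast
    refine Finset.sum_congr rfl fun i _ => Finset.sum_congr rfl fun j _ => ?_
    rw [real_inner_complex, real_inner_complex]
    simp
    ring
  simp_rw [h]
  rw [integral_fintype_prod_eq_prod (fun (i : Fin m) (x : Fin n → ℂ) =>
    ∏ j, Complex.exp ((inner ℝ (x j) (star (w i * u j) * t) : ℝ) * Complex.I))]
  simp_rw [fun i : Fin m => integral_fintype_prod_eq_prod (μ := fun _ => complexGaussian v)
    (fun (j : Fin n) (x : ℂ) =>
    Complex.exp ((inner ℝ x (star (w i * u j) * t) : ℝ) * Complex.I)), ← charFun_apply,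
    charFun_complexGaussian, ← Complex.exp_sum]
  congr 1
  have hw2 := vnorm_sq w
  have hu2 := vnorm_sq u
  rw [hw, one_pow] at hw2
  rw [hu, one_pow] at hu2
  rw [← Complex.ofReal_neg]
  simp_rw [← Complex.ofReal_neg, ← Complex.ofReal_sum]
  congr 1
  calc ∑ i, ∑ j, -((v : ℝ) * ‖star (w i * u j) * t‖ ^ 2 / 4)
      = -((v : ℝ) * ‖t‖ ^ 2 / 4) * ((∑ i, ‖w i‖ ^ 2) * ∑ j, ‖u j‖ ^ 2) := by
        rw [Finset.sum_mul_sum, Finset.mul_sum]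
        refine Finset.sum_congr rfl fun i _ => ?_
        rw [Finset.mul_sum]
        refine Finset.sum_congr rfl fun j _ => ?_
        rw [norm_mul, norm_star, norm_mul]
        ring
    _ = _ := by rw [← hw2, ← hu2]; ring

theorem complexGaussian_eq_withDensity {v : ℝ≥0} (hv : v ≠ 0) :
    complexGaussian v = volume.withDensity
      (fun x : ℂ => ENNReal.ofReal ((Real.pi * v)⁻¹ * Real.exp (-(‖x‖ ^ 2 / v)))) := by
  have hv2 : v / 2 ≠ 0 := by positivity
  rw [complexGaussian, gaussianReal_of_var_ne_zero _ hv2,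
    prod_withDensity (measurable_gaussianPDF _ _) (measurable_gaussianPDF _ _)]
  ext s hs
  have hm : MeasurableSet (Complex.measurableEquivRealProd.symm ⁻¹' s) :=
    Complex.measurableEquivRealProd.symm.measurable hs
  rw [MeasurableEquiv.map_apply, withDensity_apply _ hm, withDensity_apply _ hs,
    ← Complex.volume_preserving_equiv_real_prod.symm.setLIntegral_comp_preimage_emb
    Complex.measurableEquivRealProd.symm.measurableEmbedding]
  refine lintegral_congr fun p => ?_
  rw [gaussianPDF, gaussianPDF, ← ENNReal.ofReal_mul (gaussianPDFReal_nonneg _ _ _),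
    gaussianPDFReal, gaussianPDFReal, ← Complex.normSq_eq_norm_sq, Complex.normSq_apply]
  have h1 : (Complex.measurableEquivRealProd.symm p).re = p.1 := rfl
  have h2 : (Complex.measurableEquivRealProd.symm p).im = p.2 := rfl
  rw [h1, h2]
  congr 1
  rw [mul_mul_mul_comm, ← Real.exp_add, ← mul_inv, Real.mul_self_sqrt (by positivity)]
  congr 2
  · push_cast; field_simp
  · push_cast; field_simp; ring

theorem complexGaussian_singleton {v : ℝ≥0} (hv : v ≠ 0) (x : ℂ) : complexGaussian v {x} = 0 := by
  rw [complexGaussian_eq_withDensity hv]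
  exact withDensity_absolutelyContinuous _ _ (by simp)

/-- The squared modulus of a `𝒞𝒩(0, v)` variable `x` is exponentially distributed with mean `v`.
The event is written with the quotient `A / ‖x‖ ^ 2`, whose value at `x = 0` is irrelevant. -/
theorem complexGaussian_lt_div_norm_sq {v : ℝ≥0} (hv : v ≠ 0) {A c : ℝ} (hA : 0 ≤ A) (hc : 0 < c) :
    complexGaussian v {x | c < A / ‖x‖ ^ 2} = ENNReal.ofReal (1 - Real.exp (-(A / (c * v)))) := by
  have hms : MeasurableSet {x : ℂ | c < A / ‖x‖ ^ 2} :=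
    measurableSet_lt measurable_const (by fun_prop)
  set R := Real.sqrt (A / c) with hR
  have hR0 : 0 ≤ R := Real.sqrt_nonneg _
  rw [complexGaussian_eq_withDensity hv, withDensity_apply _ hms, ← lintegral_indicator hms,
    ← Complex.lintegral_comp_polarCoord_symm, polarCoord_target, Measure.volume_eq_prod,
    ← Measure.prod_restrict]
  have hcongr : ∀ᵐ p : ℝ × ℝ ∂((volume.restrict (Set.Ioi (0 : ℝ))).prod
      (volume.restrict (Set.Ioo (-Real.pi) Real.pi))), ENNReal.ofReal p.1 •
      ({x : ℂ | c < A / ‖x‖ ^ 2}.indicator (fun x : ℂ => ENNReal.ofReal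
        ((Real.pi * v)⁻¹ * Real.exp (-(‖x‖ ^ 2 / v)))) (Complex.polarCoord.symm p)) =
      (Set.Iio R).indicator (fun r => ENNReal.ofReal
        (r * ((Real.pi * v)⁻¹ * Real.exp (-(r ^ 2 / v))))) p.1 * 1 := by
    rw [Measure.prod_restrict, ae_restrict_iff' (measurableSet_Ioi.prod measurableSet_Ioo)]
    refine Filter.Eventually.of_forall fun p hp => ?_
    have hp0 : 0 < p.1 := hp.1
    have hmem : Complex.polarCoord.symm p ∈ {x : ℂ | c < A / ‖x‖ ^ 2} ↔ p.1 ∈ Set.Iio R := by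
      rw [Set.mem_ofPred_eq, Complex.norm_polarCoord_symm, sq_abs, lt_div_comm₀ hc (by positivity),
        Set.mem_Iio, hR, Real.lt_sqrt hp0.le]
    by_cases h : p.1 ∈ Set.Iio R
    · rw [Set.indicator_of_mem (hmem.2 h), Set.indicator_of_mem h, Complex.norm_polarCoord_symm,
        sq_abs, smul_eq_mul, ← ENNReal.ofReal_mul hp0.le, mul_one]
    · rw [Set.indicator_of_notMem (fun h' => h (hmem.1 h')), Set.indicator_of_notMem h]
      simp
  have hmf : Measurable ((Set.Iio R).indicator (fun r : ℝ => ENNReal.ofReal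
        (r * ((Real.pi * v)⁻¹ * Real.exp (-(r ^ 2 / v)))))) :=
    Measurable.indicator (by fun_prop) measurableSet_Iio
  rw [lintegral_congr_ae hcongr,
    lintegral_prod_mul hmf.aemeasurable (g := fun _ => 1) aemeasurable_const,
    lintegral_indicator measurableSet_Iio, Measure.restrict_restrict measurableSet_Iio,
    Set.Iio_inter_Ioi, lintegral_one, Measure.restrict_apply_univ, Real.volume_Ioo]
  have hcont : Continuous fun r : ℝ => r * ((Real.pi * v)⁻¹ * Real.exp (-(r ^ 2 / v))) := by
    fun_prop
  have hint : ∫ r in (0 : ℝ)..R, r * ((Real.pi * v)⁻¹ * Real.exp (-(r ^ 2 / v))) =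
      -(2 * Real.pi)⁻¹ * Real.exp (-(R ^ 2 / v)) - -(2 * Real.pi)⁻¹ * Real.exp (-(0 ^ 2 / v)) := by
    refine intervalIntegral.integral_eq_sub_of_hasDerivAt
      (f := fun r : ℝ => -(2 * Real.pi)⁻¹ * Real.exp (-(r ^ 2 / v))) (fun r _ => ?_)
      (hcont.intervalIntegrable _ _)
    have h1 : HasDerivAt (fun r : ℝ => -(r ^ 2 / v)) (-(2 * r / v)) r := by
      simpa using ((hasDerivAt_pow 2 r).div_const (v : ℝ)).fun_neg
    refine (h1.exp.const_mul (-(2 * Real.pi)⁻¹)).congr_deriv ?_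
    field_simp
  rw [restrict_Ioo_eq_restrict_Ioc, ← ofReal_integral_eq_lintegral_ofReal
    ((intervalIntegrable_iff_integrableOn_Ioc_of_le hR0).1 (hcont.intervalIntegrable _ _))
    ((ae_restrict_iff' measurableSet_Ioc).2 (Filter.Eventually.of_forall fun r hr => by
      have := hr.1.le
      simp only [Pi.zero_apply]
      positivity)),
    ← intervalIntegral.integral_of_le hR0, hint, ← ENNReal.ofReal_mul' (by
      have := Real.pi_pos; linarith)]
  congr 1
  have hRs : R ^ 2 / v = A / (c * v) := by
    rw [hR, Real.sq_sqrt (by positivity)]; field_simp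
  rw [hRs]
  simp
  field_simp
  ring

theorem integral_exp_neg_mul_norm_sq_complexGaussian {z : ℝ} (hz : 0 ≤ z) :
    ∫ x, Real.exp (-(z * ‖x‖ ^ 2)) ∂(complexGaussian 1) = (1 + z)⁻¹ := by
  rw [complexGaussian_eq_withDensity one_ne_zero, integral_withDensity_eq_integral_toReal_smul
    (by fun_prop) (by simp)]
  have h : ∀ x : ℂ, (ENNReal.ofReal ((Real.pi * (1 : ℝ≥0))⁻¹ *
      Real.exp (-(‖x‖ ^ 2 / (1 : ℝ≥0))))).toReal • Real.exp (-(z * ‖x‖ ^ 2)) =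
      Real.pi⁻¹ * Real.exp (-(1 + z) * ‖x‖ ^ 2) := by
    intro x
    rw [ENNReal.toReal_ofReal (by positivity), smul_eq_mul, mul_assoc, ← Real.exp_add]
    simp
    ring
  simp_rw [h]
  rw [integral_const_mul, GaussianFourier.integral_rexp_neg_mul_sq_norm (by positivity)]
  simp
  field_simp

/-- For a vector `h` of `k` i.i.d. `𝒞𝒩(0, 1)` entries, `‖h‖ ^ 2` is Gamma distributed; this is its
Laplace transform. -/
theorem lintegral_one_sub_exp_neg_mul_vnorm_sq (k : ℕ) {z : ℝ} (hz : 0 ≤ z) :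
    ∫⁻ h, ENNReal.ofReal (1 - Real.exp (-(z * vnorm h ^ 2)))
      ∂(Measure.pi fun _ : Fin k => complexGaussian 1) =
      ENNReal.ofReal (1 - ((1 + z) ^ k)⁻¹) := by
  have hm : Measurable fun h : Fin k → ℂ => Real.exp (-(z * vnorm h ^ 2)) := by
    simp only [vnorm_sq]; fun_prop
  have hle : ∀ h : Fin k → ℂ, Real.exp (-(z * vnorm h ^ 2)) ≤ 1 := fun h =>
    Real.exp_le_one_iff.2 (by have : 0 ≤ z * vnorm h ^ 2 := by positivity
                              linarith)
  have hi : Integrable (fun h : Fin k → ℂ => Real.exp (-(z * vnorm h ^ 2)))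
      (Measure.pi fun _ : Fin k => complexGaussian 1) :=
    Integrable.of_bound hm.aestronglyMeasurable 1 (Filter.Eventually.of_forall fun h => by
      rw [Real.norm_of_nonneg (Real.exp_pos _).le]; exact hle h)
  rw [← ofReal_integral_eq_lintegral_ofReal
    (f := fun h : Fin k → ℂ => 1 - Real.exp (-(z * vnorm h ^ 2))) ((integrable_const 1).sub hi)
    (Filter.Eventually.of_forall fun h => sub_nonneg.2 (hle h)),
    integral_sub (integrable_const 1) hi]
  congr 1
  have : ∀ h : Fin k → ℂ, Real.exp (-(z * vnorm h ^ 2)) =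
      ∏ i, Real.exp (-(z * ‖h i‖ ^ 2)) := by
    intro h
    rw [vnorm_sq, ← Real.exp_sum, Finset.mul_sum, Finset.sum_neg_distrib]
  simp_rw [this]
  rw [integral_fintype_prod_eq_pow (fun x : ℂ => Real.exp (-(z * ‖x‖ ^ 2))),
    integral_exp_neg_mul_norm_sq_complexGaussian hz]
  simp

theorem vnorm_matched {k : ℕ} {h : Fin k → ℂ} (hh : h ≠ 0) : vnorm (matched h) = 1 := by
  have hv : vnorm h ≠ 0 := by
    rw [vnorm, norm_ne_zero_iff]
    simpa using hh
  have hsq : vnorm (matched h) ^ 2 = 1 := by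
    rw [vnorm_sq]
    simp only [matched, norm_div, norm_star, div_pow, Complex.norm_real, Real.norm_eq_abs, sq_abs]
    rw [← Finset.sum_div, ← vnorm_sq, div_self (pow_ne_zero 2 hv)]
  have h0 : 0 ≤ vnorm (matched h) := norm_nonneg _
  nlinarith

theorem norm_matched_dotProduct {k : ℕ} (h : Fin k → ℂ) : ‖matched h ⬝ᵥ h‖ = vnorm h := by
  have : matched h ⬝ᵥ h = ((vnorm h ^ 2 / vnorm h : ℝ) : ℂ) := by
    rw [vnorm_sq]
    simp only [matched, dotProduct, div_mul_eq_mul_div]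
    rw [← Finset.sum_div]
    push_cast
    congr 1
    refine Finset.sum_congr rfl fun i _ => ?_
    rw [Complex.star_def, Complex.conj_mul']
  rw [this, Complex.norm_real, pow_two, mul_self_div_self, Real.norm_of_nonneg (by
    rw [vnorm]; positivity)]

theorem ae_ne_zero_pi_complexGaussian {k : ℕ} (hk : 0 < k) :
    ∀ᵐ h ∂(Measure.pi fun _ : Fin k => complexGaussian 1), h ≠ 0 := by
  have h0 : (Measure.pi fun _ : Fin k => complexGaussian 1) {0} = 0 := by
    have : ({0} : Set (Fin k → ℂ)) = Set.univ.pi fun _ => {0} := by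
      ext h; simp [funext_iff]
    rw [this, Measure.pi_pi]
    exact Finset.prod_eq_zero (Finset.mem_univ ⟨0, hk⟩) (complexGaussian_singleton one_ne_zero 0)
  rw [ae_iff]
  simpa using h0

/-! ### The nearest point of a Poisson process -/

/-- Distance from the origin to the support of a locally finite measure: the infimum of the
radii of the closed balls around the origin that are charged, and `∞` for the zero measure.
Radii are rational, so that this is a measurable function of the measure. -/
def contactDist (μ : Measure ℂ) : ℝ≥0∞ :=
  ⨅ q : ℚ, if μ (Metric.closedBall 0 (q : ℝ)) = 0 then ⊤ else ENNReal.ofReal q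

theorem measurable_contactDist : Measurable contactDist := by
  refine Measurable.iInf fun q => Measurable.ite ?_ measurable_const measurable_const
  exact (Measure.measurable_coe Metric.isClosed_closedBall.measurableSet)
    (measurableSet_singleton 0)

theorem countIn_eq_zero_iff (s : Finset ℂ) (a : ℝ) :
    countIn (Metric.closedBall 0 a) s = 0 ↔ (s.Nonempty → a < nearestDist s) := by
  classical
  have h1 : countIn (Metric.closedBall 0 a) s = 0 ↔ ∀ x ∈ s, a < ‖x‖ := by
    simp [countIn, Finset.filter_eq_empty_iff]
  rw [h1]
  constructor
  · intro h hs
    rw [nearestDist, dif_pos hs, Finset.lt_inf'_iff]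
    exact h
  · intro h x hx
    have hs : s.Nonempty := ⟨x, hx⟩
    have := h hs
    rw [nearestDist, dif_pos hs, Finset.lt_inf'_iff] at this
    exact this x hx

theorem nearestDist_nonneg (s : Finset ℂ) : 0 ≤ nearestDist s := by
  unfold nearestDist
  split_ifs with h
  · exact (Finset.le_inf'_iff _ _).2 fun x _ => norm_nonneg x
  · exact le_rfl

theorem configMeasure_closedBall_eq_zero_iff (s : Finset ℂ) (a : ℝ) :
    configMeasure s (Metric.closedBall 0 a) = 0 ↔ (s.Nonempty → a < nearestDist s) := by
  rw [configMeasure_apply s Metric.isClosed_closedBall.measurableSet, Nat.cast_eq_zero,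
    countIn_eq_zero_iff]

theorem contactDist_configMeasure_of_nonempty {s : Finset ℂ} (hs : s.Nonempty) :
    contactDist (configMeasure s) = ENNReal.ofReal (nearestDist s) := by
  unfold contactDist
  simp only [configMeasure_closedBall_eq_zero_iff, hs, forall_const]
  apply le_antisymm
  · refine le_of_forall_gt fun b hb => ?_
    obtain ⟨q, hq0, hq1, hq2⟩ := ENNReal.lt_iff_exists_rat_btwn.1 hb
    refine lt_of_le_of_lt (iInf_le _ q) ?_
    have : ¬ (q : ℝ) < nearestDist s := not_lt.2 (ENNReal.ofReal_lt_ofReal_iff'.1 hq1).1.le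
    rw [if_neg this]
    exact hq2
  · refine le_iInf fun q => ?_
    split_ifs with h
    · exact le_top
    · exact ENNReal.ofReal_le_ofReal (not_lt.1 h)

theorem contactDist_configMeasure_empty : contactDist (configMeasure ∅) = ⊤ := by
  simp [contactDist, configMeasure]

theorem nonempty_iff_contactDist_ne_top (s : Finset ℂ) :
    s.Nonempty ↔ contactDist (configMeasure s) ≠ ⊤ := by
  rcases s.eq_empty_or_nonempty with rfl | hs
  · simp [contactDist_configMeasure_empty]
  · simp [hs, contactDist_configMeasure_of_nonempty hs]

theorem nearestDist_eq_toReal_contactDist (s : Finset ℂ) :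
    nearestDist s = (contactDist (configMeasure s)).toReal := by
  rcases s.eq_empty_or_nonempty with rfl | hs
  · simp [contactDist_configMeasure_empty, nearestDist]
  · rw [contactDist_configMeasure_of_nonempty hs, ENNReal.toReal_ofReal (nearestDist_nonneg s)]

/-- The density of the distance from the origin to the nearest point of a planar Poisson
process of density `dens`. -/
def contactDensity (dens : ℝ≥0) (r : ℝ) : ℝ :=
  2 * Real.pi * dens * (r * Real.exp (-(dens : ℝ) * Real.pi * r ^ 2))

theorem continuous_contactDensity (dens : ℝ≥0) : Continuous (contactDensity dens) := by
  unfold contactDensity; fun_prop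

theorem contactDensity_nonneg (dens : ℝ≥0) {r : ℝ} (hr : 0 ≤ r) : 0 ≤ contactDensity dens r := by
  unfold contactDensity
  positivity

theorem lintegral_contactDensity (dens : ℝ≥0) {b : ℝ} (hb : 0 ≤ b) :
    ∫⁻ r in Set.Ioc 0 b, ENNReal.ofReal (contactDensity dens r) =
      ENNReal.ofReal (1 - Real.exp (-(dens : ℝ) * Real.pi * b ^ 2)) := by
  have hi := (continuous_contactDensity dens).intervalIntegrable (μ := volume) 0 b
  rw [← ofReal_integral_eq_lintegral_ofReal
    ((intervalIntegrable_iff_integrableOn_Ioc_of_le hb).1 hi)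
    ((ae_restrict_iff' measurableSet_Ioc).2 (Filter.Eventually.of_forall fun r hr =>
      contactDensity_nonneg dens hr.1.le)), ← intervalIntegral.integral_of_le hb,
    intervalIntegral.integral_eq_sub_of_hasDerivAt
      (f := fun r : ℝ => -Real.exp (-(dens : ℝ) * Real.pi * r ^ 2)) (fun r _ => ?_) hi]
  · congr 1
    simp
    ring
  · have h1 : HasDerivAt (fun r : ℝ => -(dens : ℝ) * Real.pi * r ^ 2)
        (-(dens : ℝ) * Real.pi * (2 * r)) r := by
      simpa using (hasDerivAt_pow 2 r).const_mul (-(dens : ℝ) * Real.pi)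
    refine h1.exp.fun_neg.congr_deriv ?_
    unfold contactDensity
    ring

section NearestDistance

variable {Ω : Type*} [MeasurableSpace Ω] {P : Measure Ω}

/-- The law of the nearest distance of a Poisson process in a disk, from the void
probabilities `exp (-dens * π * r ^ 2)`. The mass that is missing is the probability that the
disk is empty. -/
theorem map_nearestDist [IsProbabilityMeasure P] {Φ : Ω → Finset ℂ} {dens : ℝ≥0} {Rc : ℝ}
    (hΦ : IsPoissonProcess Φ (dens • (volume.restrict (Metric.closedBall (0 : ℂ) Rc))) P) :
    (P.restrict {ω | (Φ ω).Nonempty}).map (fun ω => nearestDist (Φ ω)) =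
      (volume.restrict (Set.Ioc 0 Rc)).withDensity
        (fun r => ENNReal.ofReal (contactDensity dens r)) := by
  have hnear : Measurable fun ω => nearestDist (Φ ω) := by
    simp_rw [nearestDist_eq_toReal_contactDist]
    exact (measurable_contactDist.comp hΦ.measurable).ennreal_toReal
  refine Measure.ext_of_Iic _ _ fun a => ?_
  -- `b` is the radius of `closedBall 0 a ∩ closedBall 0 Rc`, and `0` if that set is empty.
  set b := max (min a Rc) 0 with hb
  have hb0 : 0 ≤ b := le_max_right _ _
  have hset : Set.Iic a ∩ Set.Ioc 0 Rc = Set.Ioc 0 b := by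
    ext r
    simp only [Set.mem_inter_iff, Set.mem_Iic, Set.mem_Ioc, hb, le_max_iff, le_min_iff]
    constructor
    · rintro ⟨h1, h2, h3⟩; exact ⟨h2, Or.inl ⟨h1, h3⟩⟩
    · rintro ⟨h1, h2 | h2⟩
      · exact ⟨h2.1, h1, h2.2⟩
      · linarith
  rw [withDensity_apply _ measurableSet_Iic, Measure.restrict_restrict measurableSet_Iic, hset,
    lintegral_contactDensity dens hb0, Measure.map_apply hnear measurableSet_Iic,
    Measure.restrict_apply (hnear measurableSet_Iic)]
  have hevent : (fun ω => nearestDist (Φ ω)) ⁻¹' Set.Iic a ∩ {ω | (Φ ω).Nonempty} =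
      {ω | countIn (Metric.closedBall 0 a) (Φ ω) ≠ 0} := by
    ext ω
    simp only [Set.mem_inter_iff, Set.mem_preimage, Set.mem_Iic, Set.mem_ofPred_eq, ne_eq,
      countIn_eq_zero_iff, Classical.not_imp, not_lt, and_comm]
  have hball : Metric.closedBall (0 : ℂ) a ∩ Metric.closedBall 0 Rc =
      Metric.closedBall 0 (min a Rc) := by
    ext x; simp
  have hΛ : (dens • (volume.restrict (Metric.closedBall (0 : ℂ) Rc))) (Metric.closedBall 0 a) =
      ((dens * (b.toNNReal ^ 2 * NNReal.pi) : ℝ≥0) : ℝ≥0∞) := by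
    rw [Measure.smul_apply, Measure.restrict_apply Metric.isClosed_closedBall.measurableSet,
      hball, Complex.volume_closedBall]
    have : ENNReal.ofReal (min a Rc) = ((b.toNNReal : ℝ≥0) : ℝ≥0∞) := by
      rw [hb, ENNReal.ofReal, Real.toNNReal_of_nonneg hb0]
      congr 1
    rw [this]
    simp [ENNReal.smul_def]
  have hlaw := hΦ.count_law (Metric.closedBall 0 a) Metric.isClosed_closedBall.measurableSet
    (by rw [hΛ]; exact ENNReal.coe_ne_top)
  rw [hΛ, ENNReal.toNNReal_coe] at hlaw
  rw [hevent, hlaw.measure_eq (p := fun n : ℕ => n ≠ 0) (MeasurableSet.of_discrete)]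
  have hc : {n : ℕ | n ≠ 0} = {0}ᶜ := rfl
  rw [hc, prob_compl_eq_one_sub (measurableSet_singleton 0), poissonMeasure_singleton,
    ← ENNReal.ofReal_one, ← ENNReal.ofReal_sub _ (by positivity)]
  congr 1
  simp [Real.coe_toNNReal b hb0]
  ring

/-- The event that the disk is not empty and that the nearest distance, together with an
independent `Z`, lies in `T`, by conditioning on the nearest distance. -/
theorem measure_nonempty_and_nearestDist_mem [IsProbabilityMeasure P] {Φ : Ω → Finset ℂ}
    {dens : ℝ≥0} {Rc : ℝ}
    (hΦ : IsPoissonProcess Φ (dens • (volume.restrict (Metric.closedBall (0 : ℂ) Rc))) P)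
    {β : Type*} [MeasurableSpace β] {Z : Ω → β} (hZ : AEMeasurable Z P)
    (hind : IndepFun (fun ω => configMeasure (Φ ω)) Z P)
    {T : Set (ℝ × β)} (hT : MeasurableSet T) :
    P {ω | (Φ ω).Nonempty ∧ (nearestDist (Φ ω), Z ω) ∈ T} =
      ∫⁻ r in Set.Ioc 0 Rc, ENNReal.ofReal (contactDensity dens r) *
        (P.map Z) (Prod.mk r ⁻¹' T) := by
  have hcd := measurable_contactDist.comp hΦ.measurable
  have hnear : Measurable fun ω => nearestDist (Φ ω) := by
    simp_rw [nearestDist_eq_toReal_contactDist]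
    exact hcd.ennreal_toReal
  have hne : MeasurableSet {ω | (Φ ω).Nonempty} := by
    simp_rw [nonempty_iff_contactDist_ne_top]
    exact hcd (measurableSet_singleton ⊤).compl
  let T' : Set (Measure ℂ × β) :=
    {p | contactDist p.1 ≠ ⊤ ∧ ((contactDist p.1).toReal, p.2) ∈ T}
  have hT' : MeasurableSet T' := by
    have h1 : Measurable fun p : Measure ℂ × β => contactDist p.1 :=
      measurable_contactDist.comp measurable_fst
    exact (h1 (measurableSet_singleton ⊤).compl).inter
      ((h1.ennreal_toReal.prodMk measurable_snd) hT)
  have hK : Measurable fun r => (P.map Z) (Prod.mk r ⁻¹' T) := measurable_measure_prodMk_left hT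
  have hev : {ω | (Φ ω).Nonempty ∧ (nearestDist (Φ ω), Z ω) ∈ T} =
      (fun ω => (configMeasure (Φ ω), Z ω)) ⁻¹' T' := by
    ext ω
    simp only [T', Set.mem_preimage, Set.mem_ofPred_eq, nonempty_iff_contactDist_ne_top,
      nearestDist_eq_toReal_contactDist]
  rw [hev, ← Measure.map_apply_of_aemeasurable (hΦ.measurable.aemeasurable.prodMk hZ) hT']
  rw [(indepFun_iff_map_prod_eq_prod_map_map hΦ.measurable.aemeasurable hZ).1 hind,
    Measure.prod_apply hT', lintegral_map (measurable_measure_prodMk_left hT') hΦ.measurable]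
  have hind' : ∀ ω, (P.map Z) (Prod.mk (configMeasure (Φ ω)) ⁻¹' T') =
      {ω | (Φ ω).Nonempty}.indicator
        (fun ω => (P.map Z) (Prod.mk (nearestDist (Φ ω)) ⁻¹' T)) ω := by
    intro ω
    by_cases h : (Φ ω).Nonempty
    · rw [Set.indicator_of_mem (by exact h)]
      congr 1
      ext z
      simp only [T', Set.mem_preimage, Set.mem_ofPred_eq, ← nonempty_iff_contactDist_ne_top,
        ← nearestDist_eq_toReal_contactDist, h, true_and]
    · rw [Set.indicator_of_notMem (by exact h)]
      convert measure_empty (μ := P.map Z)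
      ext z
      simp only [T', Set.mem_preimage, Set.mem_ofPred_eq, ← nonempty_iff_contactDist_ne_top,
        h, false_and, Set.mem_empty_iff_false]
  simp_rw [hind']
  rw [lintegral_indicator hne, ← lintegral_map hK hnear, map_nearestDist hΦ,
    lintegral_withDensity_eq_lintegral_mul _
      (continuous_contactDensity dens).measurable.ennreal_ofReal hK]
  rfl

end NearestDistance

/-! ### The conditional tail of the SINR -/

theorem norm_ulPosition_sq (d r θ : ℝ) :
    ‖ulPosition d r θ‖ ^ 2 = r ^ 2 + d ^ 2 - 2 * r * d * Real.cos θ := by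
  have h : ulPosition d r θ = ((r - d * Real.cos θ : ℝ) : ℂ) + ((-d * Real.sin θ : ℝ) : ℂ) *
      Complex.I := by
    rw [ulPosition, Complex.exp_mul_I]
    push_cast
    ring
  rw [h, ← Complex.normSq_eq_norm_sq, Complex.normSq_add_mul_I]
  linear_combination d ^ 2 * Real.sin_sq_add_cos_sq θ

theorem pathLoss_ulPosition (α d r θ : ℝ) :
    pathLoss α (ulPosition d r θ) =
      (r ^ 2 + d ^ 2 - 2 * r * d * Real.cos θ) ^ (-(α / 2)) := by
  rw [pathLoss, ← norm_ulPosition_sq, ← Real.rpow_natCast_mul (norm_nonneg _)]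
  congr 1
  push_cast
  ring

theorem pathLoss_nonneg (α : ℝ) (x : ℂ) : 0 ≤ pathLoss α x := by
  unfold pathLoss; positivity

theorem measurable_vnorm {k : ℕ} : Measurable (vnorm : (Fin k → ℂ) → ℝ) := by
  unfold vnorm; fun_prop

theorem measurable_matched {k : ℕ} : Measurable (matched : (Fin k → ℂ) → (Fin k → ℂ)) := by
  have := measurable_vnorm (k := k)
  unfold matched
  refine measurable_pi_lambda _ fun i => ?_
  have hi : Measurable fun h : Fin k → ℂ => star (h i) :=
    continuous_star.measurable.comp (measurable_pi_apply i)
  exact hi.div (Complex.measurable_ofReal.comp this)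

theorem measurable_sinrAP (nu nd : ℕ) (Pu Pa α d noise : ℝ) :
    Measurable fun p : ℝ × ℝ × (Fin nu → ℂ) × (Fin nu → Fin nd → ℂ) × (Fin nd → ℂ) =>
      sinrAP Pu Pa α noise (ulPosition d p.1 p.2.1) (matched p.2.2.1) p.2.2.1
        (Matrix.of p.2.2.2.1) (matched p.2.2.2.2) := by
  have h1 := measurable_vnorm (k := nu)
  have h2 := measurable_matched (k := nu)
  have h3 := measurable_matched (k := nd)
  have e1 : ∀ i, Measurable fun h : Fin nu → ℂ => matched h i := fun i =>
    (measurable_pi_apply i).comp h2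
  have e2 : ∀ i, Measurable fun h : Fin nd → ℂ => matched h i := fun i =>
    (measurable_pi_apply i).comp h3
  simp only [sinrAP, pathLoss, ulPosition, dotProduct, Matrix.mulVec, Matrix.of_apply]
  refine Measurable.div ?_ ?_
  · refine Measurable.mul (Measurable.mul measurable_const ?_) ?_
    · refine Measurable.pow_const ?_ _
      fun_prop
    · refine (Measurable.norm ?_).pow_const _
      fun_prop
  · refine Measurable.add (Measurable.mul measurable_const ?_) (Measurable.mul measurable_const ?_)
    · refine (Measurable.norm ?_).pow_const _
      fun_prop
    · fun_prop

theorem sinrAP_nonneg {nu nd : ℕ} {Pu Pa α : ℝ} (hPu : 0 ≤ Pu) (hPa : 0 ≤ Pa) (xu : ℂ)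
    (wr h : Fin nu → ℂ) (H : Matrix (Fin nu) (Fin nd) ℂ) (wt : Fin nd → ℂ) :
    0 ≤ sinrAP Pu Pa α 0 xu wr h H wt := by
  have := pathLoss_nonneg α xu
  unfold sinrAP
  positivity

/-- The tail of the SINR over the fading, for a given position of the UL user: the interference
power is exponential given the UL channel, and the signal power is Gamma distributed. -/
theorem fading_lt_sinrAP {nu nd : ℕ} (hnu : 0 < nu) (hnd : 0 < nd) {σ2 : ℝ≥0} (hσ2 : σ2 ≠ 0)
    {Pu Pa α : ℝ} (hPu : 0 ≤ Pu) (hPa : 0 < Pa) (xu : ℂ) {x : ℝ} (hx : 0 < x) :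
    ((Measure.pi fun _ : Fin nu => complexGaussian 1).prod
      ((Measure.pi fun _ : Fin nu => Measure.pi fun _ : Fin nd => complexGaussian σ2).prod
        (Measure.pi fun _ : Fin nd => complexGaussian 1)))
      {q | x < sinrAP Pu Pa α 0 xu (matched q.1) q.1 (Matrix.of q.2.1) (matched q.2.2)} =
    ENNReal.ofReal (1 - ((1 + Pu / (Pa * σ2) * (1 / x) * pathLoss α xu) ^ nu)⁻¹) := by
  have hℓ := pathLoss_nonneg α xu
  have h1 := measurable_vnorm (k := nu)
  have h2 := measurable_matched (k := nu)
  have h3 := measurable_matched (k := nd)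
  have e1 : ∀ i, Measurable fun h : Fin nu → ℂ => matched h i := fun i =>
    (measurable_pi_apply i).comp h2
  have e2 : ∀ i, Measurable fun h : Fin nd → ℂ => matched h i := fun i =>
    (measurable_pi_apply i).comp h3
  have hT : MeasurableSet {q : (Fin nu → ℂ) × (Fin nu → Fin nd → ℂ) × (Fin nd → ℂ) |
      x < sinrAP Pu Pa α 0 xu (matched q.1) q.1 (Matrix.of q.2.1) (matched q.2.2)} := by
    refine measurableSet_lt measurable_const ?_
    simp only [sinrAP, dotProduct, Matrix.mulVec, Matrix.of_apply]
    refine Measurable.div (Measurable.mul measurable_const ?_)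
      (Measurable.add (Measurable.mul measurable_const ?_) (Measurable.mul measurable_const ?_))
    · exact (Measurable.norm (by fun_prop)).pow_const _
    · exact (Measurable.norm (by fun_prop)).pow_const _
    · fun_prop
  rw [Measure.prod_apply hT,
    ← lintegral_one_sub_exp_neg_mul_vnorm_sq nu (z := Pu / (Pa * σ2) * (1 / x) * pathLoss α xu)
      (by positivity)]
  refine lintegral_congr_ae ?_
  -- The combiner is a unit vector only for `h ≠ 0`.
  filter_upwards [ae_ne_zero_pi_complexGaussian hnu] with h hh
  rw [Measure.prod_apply_symm (measurable_prodMk_left hT)]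
  have hin : ∀ᵐ u ∂(Measure.pi fun _ : Fin nd => complexGaussian 1),
      (Measure.pi fun _ : Fin nu => Measure.pi fun _ : Fin nd => complexGaussian σ2)
        ((fun H => (H, u)) ⁻¹' (Prod.mk h ⁻¹' {q | x < sinrAP Pu Pa α 0 xu (matched q.1) q.1
          (Matrix.of q.2.1) (matched q.2.2)})) =
      ENNReal.ofReal (1 - Real.exp (-(Pu / (Pa * σ2) * (1 / x) * pathLoss α xu *
        vnorm h ^ 2))) := by
    filter_upwards [ae_ne_zero_pi_complexGaussian hnd] with u hu
    have hm : Measurable fun H : Fin nu → Fin nd → ℂ =>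
        matched h ⬝ᵥ (Matrix.of H *ᵥ matched u) := by
      simp only [dotProduct, Matrix.mulVec, Matrix.of_apply]
      fun_prop
    have hset : (fun H => (H, u)) ⁻¹' (Prod.mk h ⁻¹' {q | x < sinrAP Pu Pa α 0 xu (matched q.1) q.1
          (Matrix.of q.2.1) (matched q.2.2)}) =
        (fun H : Fin nu → Fin nd → ℂ => matched h ⬝ᵥ (Matrix.of H *ᵥ matched u)) ⁻¹'
          {y | x < (Pu * pathLoss α xu * vnorm h ^ 2 / Pa) / ‖y‖ ^ 2} := by
      ext H
      simp only [Set.mem_preimage, Set.mem_ofPred_eq, sinrAP, norm_matched_dotProduct, zero_mul,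
        add_zero, div_div]
    rw [hset, ← Measure.map_apply hm (measurableSet_lt measurable_const (by fun_prop)),
      map_dotProduct_mulVec_complexGaussian σ2 (vnorm_matched hh) (vnorm_matched hu),
      complexGaussian_lt_div_norm_sq hσ2 (by positivity) hx]
    congr 4
    field_simp
  rw [lintegral_congr_ae hin, lintegral_const, measure_univ, mul_one]

/-! ### Absolute convergence of the triple integral -/

/-- The real integrand of the rate formula: its integral over `(t, r, θ)`, multiplied by `dens`, is
the average rate. It is `rateIntegrand / Γ(nu)` with the Meijer G-function evaluated. -/
def rateKernel (nu : ℕ) (dens σ2 : ℝ≥0) (Pu Pa α d t r θ : ℝ) : ℝ :=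
  r * Real.exp (-(dens : ℝ) * Real.pi * r ^ 2) *
    (1 - ((1 + Pu / (Pa * (σ2 : ℝ)) * (1 / ((2 : ℝ) ^ t - 1)) *
      (r ^ 2 + d ^ 2 - 2 * r * d * Real.cos θ) ^ (-(α / 2))) ^ nu)⁻¹)

section Kernel

variable {nu : ℕ} {dens σ2 : ℝ≥0} {Pu Pa α d : ℝ}

theorem two_rpow_sub_one_pos {t : ℝ} (ht : 0 < t) : 0 < (2 : ℝ) ^ t - 1 :=
  sub_pos.2 (Real.one_lt_rpow (by norm_num) ht)

theorem sq_sub_le_law_of_cosines (r d θ : ℝ) (hr : 0 ≤ r) (hd : 0 ≤ d) :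
    (r - d) ^ 2 ≤ r ^ 2 + d ^ 2 - 2 * r * d * Real.cos θ := by
  nlinarith [mul_nonneg (mul_nonneg hr hd) (sub_nonneg.2 (Real.cos_le_one θ))]

theorem snr_nonneg (hPu : 0 < Pu) (hPa : 0 < Pa) {t : ℝ} (ht : 0 < t) (r θ : ℝ) :
    0 ≤ Pu / (Pa * (σ2 : ℝ)) * (1 / ((2 : ℝ) ^ t - 1)) *
      (r ^ 2 + d ^ 2 - 2 * r * d * Real.cos θ) ^ (-(α / 2)) := by
  have := two_rpow_sub_one_pos ht
  rw [← norm_ulPosition_sq]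
  positivity

theorem rateIntegrand_eq (hnu : 1 < nu) (hPu : 0 < Pu) (hPa : 0 < Pa) {t : ℝ} (ht : 0 < t)
    (r θ : ℝ) :
    rateIntegrand nu dens σ2 Pu Pa α d t r θ =
      ((Real.Gamma nu * rateKernel nu dens σ2 Pu Pa α d t r θ : ℝ) : ℂ) := by
  rw [rateIntegrand, meijerG_eq nu hnu (snr_nonneg hPu hPa ht r θ), rateKernel,
    ← Complex.ofReal_mul]
  congr 1
  ring

theorem one_sub_inv_pow_nonneg (n : ℕ) {z : ℝ} (hz : 0 ≤ z) : 0 ≤ 1 - ((1 + z) ^ n)⁻¹ :=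
  sub_nonneg.2 (inv_le_one_of_one_le₀ (one_le_pow₀ (by linarith)))

theorem one_sub_inv_pow_le {n : ℕ} (hn : 1 ≤ n) {z p : ℝ} (hz : 0 ≤ z) (hp : 0 ≤ p)
    (hp1 : p ≤ 1) : 1 - ((1 + z) ^ n)⁻¹ ≤ n * z ^ p := by
  have hn1 : (1 : ℝ) ≤ n := by exact_mod_cast hn
  rcases le_or_gt 1 z with h | h
  · have h1 : 0 ≤ ((1 + z) ^ n)⁻¹ := by positivity
    have h2 : 1 ≤ z ^ p := Real.one_le_rpow h hp
    nlinarith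
  · have h1 : z ≤ z ^ p := by
      rcases hz.eq_or_lt with rfl | hz
      · positivity
      · simpa using Real.rpow_le_rpow_of_exponent_ge hz h.le hp1
    have h2 : 1 - z ≤ (1 + z)⁻¹ := by
      rw [← one_div, le_div_iff₀ (by positivity)]
      nlinarith
    have h3 : 1 - n * z ≤ ((1 + z) ^ n)⁻¹ := by
      have := one_add_mul_le_pow (a := -z) (by linarith) n
      rw [← inv_pow]
      calc 1 - n * z = 1 + n * (-z) := by ring
        _ ≤ (1 + -z) ^ n := this
        _ ≤ _ := pow_le_pow_left₀ (by linarith) (by linarith) n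
    nlinarith

theorem rateKernel_nonneg (hPu : 0 < Pu) (hPa : 0 < Pa) {t : ℝ} (ht : 0 < t) {r : ℝ} (hr : 0 ≤ r)
    (θ : ℝ) : 0 ≤ rateKernel nu dens σ2 Pu Pa α d t r θ := by
  have := one_sub_inv_pow_nonneg nu (snr_nonneg (σ2 := σ2) (α := α) (d := d) hPu hPa ht r θ)
  unfold rateKernel
  positivity

theorem measurable_rateKernel : Measurable fun x : ℝ × ℝ × ℝ =>
    rateKernel nu dens σ2 Pu Pa α d x.1 x.2.1 x.2.2 := by
  unfold rateKernel
  fun_prop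

/-- Growth of `2 ^ t - 1` at both ends of `(0, ∞)`. -/
theorem mul_exp_le_two_rpow_sub_one {t : ℝ} (ht : 0 < t) :
    (Real.log 2 / 2 * t) * Real.exp (Real.log 2 / 2 * t) ≤ (2 : ℝ) ^ t - 1 := by
  set u := Real.log 2 / 2 * t with hu
  have hu0 : 0 < u := by positivity
  have h2 : (2 : ℝ) ^ t = Real.exp u * Real.exp u := by
    rw [Real.rpow_def_of_pos (by norm_num), ← Real.exp_add, hu]
    congr 1
    ring
  have h3 := Real.add_one_le_exp u
  rw [h2]
  nlinarith

theorem integrableOn_abs_sub_rpow (d Rc : ℝ) (hRc : 0 ≤ Rc) :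
    IntegrableOn (fun r : ℝ => |r - d| ^ (-(1 / 2) : ℝ)) (Set.Ioc 0 Rc) := by
  -- The complex power has modulus `|x| ^ (-1 / 2)` also for `x < 0`, unlike the real power.
  have h := (intervalIntegral.intervalIntegrable_cpow' (a := 0 - d) (b := Rc - d)
    (r := ((-(1 / 2) : ℝ) : ℂ)) (by rw [Complex.ofReal_re]; norm_num)).norm
  have h2 : IntervalIntegrable (fun x : ℝ => |x| ^ (-(1 / 2) : ℝ)) volume (0 - d) (Rc - d) := by
    refine h.congr (fun x _ => ?_)
    simp only [Complex.norm_cpow_real, Complex.norm_real, Real.norm_eq_abs]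
  have h3 := h2.comp_sub_right d
  simp only [sub_add_cancel] at h3
  exact (intervalIntegrable_iff_integrableOn_Ioc_of_le hRc).1 h3

/-- Absolute convergence. The bound `1 - (1 + z)⁻ⁿ ≤ n z ^ p` with `p = 1 / (2 α)` splits the
kernel into a function of `t` that is integrable at `0` and at `∞`, and the function
`|r - d| ^ (-1 / 2)`, which dominates the singularity at the position of the access point. -/
theorem integrableOn_rateKernel (hnu : 1 < nu) (hPu : 0 < Pu) (hPa : 0 < Pa) (hα : 2 ≤ α)
    (hd : 0 ≤ d) {Rc : ℝ} (hRc : 0 < Rc) :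
    IntegrableOn (fun x : ℝ × ℝ × ℝ => rateKernel nu dens σ2 Pu Pa α d x.1 x.2.1 x.2.2)
      (Set.Ioi 0 ×ˢ Set.Ioc 0 Rc ×ˢ Set.Ioc 0 (2 * Real.pi)) := by
  set p : ℝ := 1 / (2 * α) with hp
  have hp0 : 0 < p := by positivity
  have hp1 : p ≤ 1 / 4 := by
    rw [hp]; exact one_div_le_one_div_of_le (by norm_num) (by linarith)
  set b : ℝ := Real.log 2 / 2 with hb
  have hb0 : 0 < b := by positivity
  set K : ℝ := Pu / (Pa * σ2) with hK
  have hK0 : 0 ≤ K := by positivity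
  have hG : IntegrableOn (fun t : ℝ => t ^ (-p) * Real.exp (-(p * b) * t)) (Set.Ioi 0) := by
    have := integrableOn_rpow_mul_exp_neg_mul_rpow (p := 1) (s := -p) (b := p * b) (by linarith)
      one_pos (by positivity)
    simpa using this
  have hdom : IntegrableOn (fun x : ℝ × ℝ × ℝ => Rc * (nu * (K ^ p * b ^ (-p))) *
      ((x.1 ^ (-p) * Real.exp (-(p * b) * x.1)) * (|x.2.1 - d| ^ (-(1 / 2) : ℝ) * 1)))
      (Set.Ioi 0 ×ˢ Set.Ioc 0 Rc ×ˢ Set.Ioc 0 (2 * Real.pi)) := by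
    refine Integrable.const_mul ?_ _
    rw [Measure.volume_eq_prod, Measure.volume_eq_prod, ← Measure.prod_restrict,
      ← Measure.prod_restrict]
    have h1 : Integrable (fun y : ℝ × ℝ => |y.1 - d| ^ (-(1 / 2) : ℝ) * 1)
        ((volume.restrict (Set.Ioc 0 Rc)).prod (volume.restrict (Set.Ioc 0 (2 * Real.pi)))) :=
      Integrable.mul_prod (f := fun r : ℝ => |r - d| ^ (-(1 / 2) : ℝ)) (g := fun _ : ℝ => (1 : ℝ))
        (integrableOn_abs_sub_rpow d Rc hRc.le) (integrable_const 1)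
    exact Integrable.mul_prod (f := fun t : ℝ => t ^ (-p) * Real.exp (-(p * b) * t)) hG h1
  -- At `r = d` the dominating function takes the junk value `0 ^ (-1 / 2) = 0`.
  have hne : ∀ᵐ x : ℝ × ℝ × ℝ, x.2.1 ≠ d := by
    have h0 : ∀ᵐ r : ℝ, r ≠ d := by simp [ae_iff]
    have h1 : ∀ᵐ y : ℝ × ℝ, y.1 ≠ d := Measure.quasiMeasurePreserving_fst.ae h0
    exact Measure.quasiMeasurePreserving_snd.ae h1
  refine Integrable.mono' hdom measurable_rateKernel.aestronglyMeasurable ?_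
  rw [ae_restrict_iff' (measurableSet_Ioi.prod (measurableSet_Ioc.prod measurableSet_Ioc))]
  filter_upwards [hne] with x hxd hx
  obtain ⟨t, r, θ⟩ := x
  have ht : 0 < t := hx.1
  have hr : 0 < r := hx.2.1.1
  have hrR : r ≤ Rc := hx.2.1.2
  simp only at hxd ⊢
  rw [Real.norm_of_nonneg (rateKernel_nonneg hPu hPa ht hr.le θ), rateKernel, ← hK]
  have hz := snr_nonneg (σ2 := σ2) (α := α) (d := d) hPu hPa ht r θ
  rw [← hK] at hz
  have hexp : Real.exp (-(dens : ℝ) * Real.pi * r ^ 2) ≤ 1 := by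
    refine Real.exp_le_one_iff.2 ?_
    have : 0 ≤ (dens : ℝ) * Real.pi * r ^ 2 := by have := Real.pi_pos; positivity
    linarith
  have htpos := two_rpow_sub_one_pos ht
  have hcos := sq_sub_le_law_of_cosines r d θ hr.le hd
  set B := r ^ 2 + d ^ 2 - 2 * r * d * Real.cos θ with hB
  have hrd : 0 < (r - d) ^ 2 := by
    positivity
  have hB0 : 0 < B := hrd.trans_le hcos
  have hBp : (B ^ (-(α / 2))) ^ p ≤ |r - d| ^ (-(1 / 2) : ℝ) := by
    rw [← Real.rpow_mul hB0.le, show -(α / 2) * p = -(1 / 4) by rw [hp]; field_simp; norm_num]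
    calc B ^ (-(1 / 4) : ℝ) ≤ ((r - d) ^ 2) ^ (-(1 / 4) : ℝ) :=
          Real.rpow_le_rpow_of_nonpos hrd hcos (by norm_num)
      _ = |r - d| ^ (-(1 / 2) : ℝ) := by
          rw [← sq_abs, ← Real.rpow_natCast_mul (abs_nonneg _)]
          norm_num
  have htp : (1 / ((2 : ℝ) ^ t - 1)) ^ p ≤ b ^ (-p) * (t ^ (-p) * Real.exp (-(p * b) * t)) := by
    have h1 := mul_exp_le_two_rpow_sub_one ht
    rw [← hb] at h1
    rw [one_div, Real.inv_rpow htpos.le, ← Real.rpow_neg htpos.le]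
    calc ((2 : ℝ) ^ t - 1) ^ (-p) ≤ (b * t * Real.exp (b * t)) ^ (-p) :=
          Real.rpow_le_rpow_of_nonpos (by positivity) h1 (by linarith)
      _ = _ := by
          rw [Real.mul_rpow (by positivity) (Real.exp_pos _).le, Real.mul_rpow hb0.le ht.le,
            ← Real.exp_mul, mul_assoc]
          congr 3
          ring
  have hzp : (K * (1 / ((2 : ℝ) ^ t - 1)) * B ^ (-(α / 2))) ^ p ≤
      K ^ p * (b ^ (-p) * (t ^ (-p) * Real.exp (-(p * b) * t))) * |r - d| ^ (-(1 / 2) : ℝ) := by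
    rw [Real.mul_rpow (by positivity) (by positivity), Real.mul_rpow hK0 (by positivity)]
    gcongr
  have hmain := one_sub_inv_pow_le (n := nu) hnu.le hz hp0.le (by linarith)
  have hnn := one_sub_inv_pow_nonneg nu hz
  calc r * Real.exp (-(dens : ℝ) * Real.pi * r ^ 2) *
        (1 - ((1 + K * (1 / ((2 : ℝ) ^ t - 1)) * B ^ (-(α / 2))) ^ nu)⁻¹)
      ≤ (Rc * 1) * (nu * (K ^ p * (b ^ (-p) * (t ^ (-p) * Real.exp (-(p * b) * t))) *
          |r - d| ^ (-(1 / 2) : ℝ))) := by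
        refine mul_le_mul ?_ (hmain.trans ?_) hnn (by positivity)
        · exact mul_le_mul hrR hexp (Real.exp_pos _).le hRc.le
        · exact mul_le_mul_of_nonneg_left hzp (by positivity)
    _ = _ := by ring

end Kernel

/-! ### The tail of the uplink rate -/

variable {Ω : Type*} [MeasurableSpace Ω] {P : Measure Ω} {nu nd : ℕ} {S : System Ω nu nd}
  {dens σ2 : ℝ≥0} {Rc Pu Pa α d : ℝ}

/-- The random quantities of a system other than the locations of the DL users. -/
def System.marks {Ω : Type*} {nu nd : ℕ} (S : System Ω nu nd) (ω : Ω) :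
    ℝ × (Fin nu → ℂ) × (Fin nu → Fin nd → ℂ) × (Fin nd → ℂ) :=
  (S.theta ω, S.hua ω, S.haa ω, S.had ω)

theorem System.IsModel.aemeasurable_marks (hS : S.IsModel dens σ2 Rc P) :
    AEMeasurable S.marks P :=
  hS.theta_law.aemeasurable.prodMk (hS.hua_law.aemeasurable.prodMk
    (hS.haa_law.aemeasurable.prodMk hS.had_law.aemeasurable))

theorem System.IsModel.map_marks [IsProbabilityMeasure P] (hS : S.IsModel dens σ2 Rc P) :
    P.map S.marks = (cond volume (Set.Icc 0 (2 * Real.pi))).prod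
      ((Measure.pi fun _ : Fin nu => complexGaussian 1).prod
        ((Measure.pi fun _ : Fin nu => Measure.pi fun _ : Fin nd => complexGaussian σ2).prod
          (Measure.pi fun _ : Fin nd => complexGaussian 1))) := by
  have m1 := hS.theta_law.aemeasurable
  have m2 := hS.hua_law.aemeasurable
  have m3 := hS.haa_law.aemeasurable
  have m4 := hS.had_law.aemeasurable
  have e1 := (indepFun_iff_map_prod_eq_prod_map_map m3 m4).1 hS.haa_indep
  have e2 := (indepFun_iff_map_prod_eq_prod_map_map m2 (m3.prodMk m4)).1 hS.hua_indep
  have e3 := (indepFun_iff_map_prod_eq_prod_map_map m1 (m2.prodMk (m3.prodMk m4))).1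
    hS.theta_indep
  rw [hS.haa_law.map_eq, hS.had_law.map_eq] at e1
  rw [e1, hS.hua_law.map_eq] at e2
  rw [e2, hS.theta_law.map_eq] at e3
  exact e3

theorem System.ulRate_nonneg {Ω : Type*} {S : System Ω nu nd} (hPu : 0 ≤ Pu)
    (hPa : 0 ≤ Pa) (ω : Ω) :
    0 ≤ S.ulRate Pu Pa α d 0 ω := by
  refine Real.logb_nonneg (by norm_num) ?_
  unfold System.sinrMrcMrt
  split_ifs
  · have := sinrAP_nonneg (α := α) hPu hPa (ulPosition d (nearestDist (S.users ω)) (S.theta ω))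
      (matched (S.hua ω)) (S.hua ω) (Matrix.of (S.haa ω)) (matched (S.had ω))
    linarith
  · simp

theorem System.IsModel.aemeasurable_ulRate (hS : S.IsModel dens σ2 Rc P) :
    AEMeasurable (S.ulRate Pu Pa α d 0) P := by
  have hcd := measurable_contactDist.comp hS.users_poisson.measurable
  have hnear : Measurable fun ω => nearestDist (S.users ω) := by
    simp_rw [nearestDist_eq_toReal_contactDist]
    exact hcd.ennreal_toReal
  have hne : MeasurableSet {ω | (S.users ω).Nonempty} := by
    simp_rw [nonempty_iff_contactDist_ne_top]
    exact hcd (measurableSet_singleton ⊤).compl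
  have h1 := (measurable_sinrAP nu nd Pu Pa α d 0).comp_aemeasurable
    (hnear.aemeasurable.prodMk hS.aemeasurable_marks)
  have h2 : AEMeasurable (fun ω => S.sinrMrcMrt Pu Pa α d 0 ω) P := by
    refine (h1.indicator hne).congr (Filter.Eventually.of_forall fun ω => ?_)
    by_cases h : (S.users ω).Nonempty
    · rw [Set.indicator_of_mem (by exact h)]
      exact (if_pos h).symm
    · rw [Set.indicator_of_notMem (by exact h)]
      exact (if_neg h).symm
  unfold System.ulRate Real.logb
  exact (Real.measurable_log.comp_aemeasurable (h2.const_add 1)).div_const _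

/-- The tail of the UL rate: the fading is integrated out first, then the direction of the UL
user, and then the distance of the nearest DL user. -/
theorem System.IsModel.measure_lt_ulRate [IsProbabilityMeasure P] (hS : S.IsModel dens σ2 Rc P)
    (hnu : 0 < nu) (hnd : 0 < nd) (hσ2 : σ2 ≠ 0) (hPu : 0 < Pu) (hPa : 0 < Pa)
    {t : ℝ} (ht : 0 < t) :
    P {ω | t < S.ulRate Pu Pa α d 0 ω} =
      ∫⁻ r in Set.Ioc 0 Rc, ∫⁻ θ in Set.Ioc 0 (2 * Real.pi),
        ENNReal.ofReal (dens * rateKernel nu dens σ2 Pu Pa α d t r θ) := by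
  have hx := two_rpow_sub_one_pos ht
  let T : Set (ℝ × ℝ × (Fin nu → ℂ) × (Fin nu → Fin nd → ℂ) × (Fin nd → ℂ)) :=
    {p | (2 : ℝ) ^ t - 1 < sinrAP Pu Pa α 0 (ulPosition d p.1 p.2.1) (matched p.2.2.1) p.2.2.1
      (Matrix.of p.2.2.2.1) (matched p.2.2.2.2)}
  have hT : MeasurableSet T :=
    measurableSet_lt measurable_const (measurable_sinrAP nu nd Pu Pa α d 0)
  have hset : {ω | t < S.ulRate Pu Pa α d 0 ω} =
      {ω | (S.users ω).Nonempty ∧ (nearestDist (S.users ω), S.marks ω) ∈ T} := by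
    ext ω
    simp only [Set.mem_ofPred_eq, System.ulRate, System.sinrMrcMrt, System.marks, T]
    by_cases h : (S.users ω).Nonempty
    · have h0 := sinrAP_nonneg (α := α) hPu.le hPa.le
        (ulPosition d (nearestDist (S.users ω)) (S.theta ω))
        (matched (S.hua ω)) (S.hua ω) (Matrix.of (S.haa ω)) (matched (S.had ω))
      rw [if_pos h, Real.lt_logb_iff_rpow_lt (by norm_num) (by linarith), sub_lt_iff_lt_add']
      simp only [h, true_and]
    · simp [h, ht.le]
  rw [hset, measure_nonempty_and_nearestDist_mem hS.users_poisson hS.aemeasurable_marks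
    hS.users_indep hT]
  refine setLIntegral_congr_fun measurableSet_Ioc fun r hr => ?_
  have hr0 : 0 ≤ r := hr.1.le
  rw [hS.map_marks, Measure.prod_apply (measurable_prodMk_left hT)]
  have hin : ∀ θ : ℝ, ((Measure.pi fun _ : Fin nu => complexGaussian 1).prod
        ((Measure.pi fun _ : Fin nu => Measure.pi fun _ : Fin nd => complexGaussian σ2).prod
          (Measure.pi fun _ : Fin nd => complexGaussian 1))) (Prod.mk θ ⁻¹' (Prod.mk r ⁻¹' T)) =
      ENNReal.ofReal (1 - ((1 + Pu / (Pa * σ2) * (1 / ((2 : ℝ) ^ t - 1)) *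
        (r ^ 2 + d ^ 2 - 2 * r * d * Real.cos θ) ^ (-(α / 2))) ^ nu)⁻¹) := by
    intro θ
    rw [← pathLoss_ulPosition, ← fading_lt_sinrAP hnu hnd hσ2 hPu.le hPa _ hx]
    rfl
  simp_rw [hin]
  rw [ProbabilityTheory.cond, lintegral_smul_measure, Real.volume_Icc, sub_zero, smul_eq_mul,
    ← restrict_Ioc_eq_restrict_Icc, ← ENNReal.ofReal_inv_of_pos (by positivity), ← mul_assoc,
    ← ENNReal.ofReal_mul (contactDensity_nonneg dens hr0),
    ← lintegral_const_mul' _ _ ENNReal.ofReal_ne_top]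
  refine lintegral_congr fun θ => ?_
  rw [← ENNReal.ofReal_mul (mul_nonneg (contactDensity_nonneg dens hr0) (by positivity))]
  congr 1
  unfold contactDensity rateKernel
  field_simp

end FullDuplex
end

theorem proposition3 {Ω : Type*} [MeasurableSpace Ω] (P : Measure Ω) [IsProbabilityMeasure P]
    (nu : ℕ) (hnu : 1 < nu) (S : FullDuplex.System Ω nu 1)
    (dens σ2 : ℝ≥0) (hdens : 0 < dens) (hσ2 : 0 < σ2)
    (Rc Pu Pa α d : ℝ) (hRc : 0 < Rc) (hPu : 0 < Pu) (hPa : 0 < Pa) (hα : 2 ≤ α) (hd : 0 ≤ d)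
    (hS : S.IsModel dens σ2 Rc P) :
    Integrable (S.ulRate Pu Pa α d 0) P ∧
    IntegrableOn
      (fun x : ℝ × ℝ × ℝ =>
        FullDuplex.rateIntegrand nu dens σ2 Pu Pa α d x.1 x.2.1 x.2.2)
      (Set.Ioi 0 ×ˢ Set.Ioc 0 Rc ×ˢ Set.Ioc 0 (2 * Real.pi)) ∧
    ((∫ ω, S.ulRate Pu Pa α d 0 ω ∂P : ℝ) : ℂ) =
      (((dens : ℝ) / Real.Gamma nu : ℝ) : ℂ) *
        ∫ t in Set.Ioi (0 : ℝ), ∫ r in (0 : ℝ)..Rc, ∫ θ in (0 : ℝ)..(2 * Real.pi),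
          FullDuplex.rateIntegrand nu dens σ2 Pu Pa α d t r θ := by
  let J : ℝ × ℝ × ℝ → ℝ := fun x => FullDuplex.rateKernel nu dens σ2 Pu Pa α d x.1 x.2.1 x.2.2
  let μ : Measure (ℝ × ℝ × ℝ) := (volume.restrict (Set.Ioi 0)).prod
    ((volume.restrict (Set.Ioc 0 Rc)).prod (volume.restrict (Set.Ioc 0 (2 * Real.pi))))
  have hμ : μ = volume.restrict (Set.Ioi 0 ×ˢ Set.Ioc 0 Rc ×ˢ Set.Ioc 0 (2 * Real.pi)) := by
    rw [Measure.volume_eq_prod, Measure.volume_eq_prod, ← Measure.prod_restrict,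
      ← Measure.prod_restrict]
  have hbox : MeasurableSet (Set.Ioi (0 : ℝ) ×ˢ Set.Ioc 0 Rc ×ˢ Set.Ioc 0 (2 * Real.pi)) :=
    measurableSet_Ioi.prod (measurableSet_Ioc.prod measurableSet_Ioc)
  have hJm : Measurable J := FullDuplex.measurable_rateKernel
  have hJi : Integrable J μ := by
    rw [hμ]; exact FullDuplex.integrableOn_rateKernel hnu hPu hPa hα hd hRc
  have hJ0 : 0 ≤ᵐ[μ] J := by
    rw [hμ]
    exact (ae_restrict_iff' hbox).2 (Filter.Eventually.of_forall fun x hx =>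
      FullDuplex.rateKernel_nonneg hPu hPa hx.1 hx.2.1.1.le x.2.2)
  have hdJ0 : 0 ≤ᵐ[μ] fun x => (dens : ℝ) * J x := hJ0.mono fun x hx => by
    have : 0 ≤ J x := hx
    simp only [Pi.zero_apply]
    positivity
  have hrate0 : 0 ≤ᵐ[P] S.ulRate Pu Pa α d 0 :=
    Filter.Eventually.of_forall (FullDuplex.System.ulRate_nonneg hPu.le hPa.le)
  have hratem := hS.aemeasurable_ulRate (Pu := Pu) (Pa := Pa) (α := α) (d := d)
  have hlint : ∫⁻ ω, ENNReal.ofReal (S.ulRate Pu Pa α d 0 ω) ∂P =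
      ENNReal.ofReal (dens * ∫ x, J x ∂μ) := by
    have hm : Measurable fun x => ENNReal.ofReal (dens * J x) := (hJm.const_mul _).ennreal_ofReal
    rw [lintegral_eq_lintegral_meas_lt P hrate0 hratem,
      setLIntegral_congr_fun measurableSet_Ioi (fun t ht =>
        hS.measure_lt_ulRate (by omega) one_pos hσ2.ne' hPu hPa ht),
      ← integral_const_mul, ofReal_integral_eq_lintegral_ofReal (hJi.const_mul _) hdJ0,
      lintegral_prod _ hm.aemeasurable]
    refine lintegral_congr fun t => ?_
    rw [lintegral_prod (fun y => ENNReal.ofReal (dens * J (t, y)))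
      (hm.comp measurable_prodMk_left).aemeasurable]
  refine ⟨⟨hratem.aestronglyMeasurable, ?_⟩, ?_, ?_⟩
  · rw [hasFiniteIntegral_iff_ofReal hrate0, hlint]
    exact ENNReal.ofReal_lt_top
  · have h := (hJi.const_mul (Real.Gamma nu)).ofReal (𝕜 := ℂ)
    rw [hμ] at h
    exact IntegrableOn.congr_fun h (fun x hx =>
      (FullDuplex.rateIntegrand_eq hnu hPu hPa hx.1 x.2.1 x.2.2).symm) hbox
  · have hint : ∫ ω, S.ulRate Pu Pa α d 0 ω ∂P = dens * ∫ x, J x ∂μ := by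
      rw [integral_eq_lintegral_of_nonneg_ae hrate0 hratem.aestronglyMeasurable, hlint,
        ENNReal.toReal_ofReal (mul_nonneg dens.coe_nonneg (integral_nonneg_of_ae hJ0))]
    have hiter : ∫ x, J x ∂μ = ∫ t in Set.Ioi (0 : ℝ), ∫ r in (0 : ℝ)..Rc,
        ∫ θ in (0 : ℝ)..(2 * Real.pi), FullDuplex.rateKernel nu dens σ2 Pu Pa α d t r θ := by
      rw [integral_prod _ hJi]
      refine integral_congr_ae ?_
      filter_upwards [hJi.prod_right_ae] with t ht
      rw [integral_prod _ ht, intervalIntegral.integral_of_le hRc.le]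
      simp_rw [intervalIntegral.integral_of_le (show 0 ≤ 2 * Real.pi by positivity)]
      rfl
    have hG : ∫ t in Set.Ioi (0 : ℝ), ∫ r in (0 : ℝ)..Rc, ∫ θ in (0 : ℝ)..(2 * Real.pi),
          FullDuplex.rateIntegrand nu dens σ2 Pu Pa α d t r θ =
        ((Real.Gamma nu * ∫ x, J x ∂μ : ℝ) : ℂ) := by
      rw [hiter, ← integral_const_mul, ← integral_complex_ofReal]
      refine setIntegral_congr_fun measurableSet_Ioi fun t ht => ?_
      simp only [FullDuplex.rateIntegrand_eq hnu hPu hPa ht, intervalIntegral.integral_ofReal,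
        intervalIntegral.integral_const_mul]
    rw [hG, hint, ← Complex.ofReal_mul]
    congr 1
    field_simp
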